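/- Let $n_r\ge n_t\ge 2$, let $\mathbf P$ be a random complex $n_r\times n_t$ matrix, let $\boldsymbol\Sigma_t$ be a deterministic positive definite Hermitian $n_t\times n_t$ matrix, put $\mathbf H=\mathbf P\sqrt{\boldsymbol\Sigma_t}$, and let $\delta>0$. Assume that $\mathbf P$ is an invariant polynomial ensemble, that is: there are real monic polynomials $p_0,\dots,p_{n_t-1}$ with $\deg p_j=j$ and real functions $q_0,\dots,q_{n_t-1}$ on $(0,\infty)$ such that every $p_aq_b$ is integrable on $(0,\infty)$ and $\int_0^\infty p_a(\lambda)q_b(\lambda)\,d\lambda=\delta_{ab}$ (Kronecker delta), and $\mathbf P^\dagger\mathbf P$ has the law of $\mathbf U^\dagger\operatorname{diag}(\lambda_1,\dots,\lambda_{n_t})\mathbf U$, where $\mathbf U$ is Haar distributed on the unitary group $\mathcal U(n_t)$, independent of $(\lambda_1,\dots,\lambda_{n_t})$, and $(\lambda_1,\dots,\lambda_{n_t})$ has on $(0,\infty)^{n_t}$ the probability density $$\frac1{n_t!}\prod_{1\le\ell<k\le n_t}(\lambda_k-\lambda_\ell)\,\det[q_{b-1}(\lambda_a)]_{a,b=1}^{n_t}.$$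 Let $K(x,y)=\sum_{j=0}^{n_t-1}p_j(x)q_j(y)$, let $\sigma_k=(\boldsymbol\Sigma_t^{-1})_{kk}$, and let $\gamma_k=\delta/[(\mathbf H^\dagger\mathbf H)^{-1}]_{kk}$ be the output SINR of the $k$-th stream of the zero-forcing receiver. Then, for every $k$, the law of $\gamma_k$ is absolutely continuous, is carried by $(0,\infty)$, and has there the density $$\rho_k(\gamma)=(n_t-1)\frac{\sigma_k}{\delta}\int_0^1K\Bigl(0,\frac{\sigma_k\gamma x}{\delta}\Bigr)(1-x)^{n_t-2}x\,dx .$$ Moreover $\ln(1+\gamma_k)$ is integrable for every $k$, and the ergodic sum rate $R=\sum_{k=1}^{n_t}\mathbb E[\ln(1+\gamma_k)]$ is $$R=(n_t-1)!\int_0^\infty K(0,x)\sum_{k=1}^{n_t}G^{2,2}_{3,3}\left(\left.\begin{array}{c}1,1;n_t\\1,1;0\end{array}\right|\frac{\delta}{\sigma_k}x\right)dx,$$ where the integral converges absolutely and, for $z>0$ and any $r\in(0,1)$, the Meijer G-function is the absolutely convergent integral $$G^{2,2}_{3,3}\left(\left.\begin{array}{c}1,1;n_t\\1,1;0\end{array}\right|z\right)=\frac1{2\pi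 i}\int_{r-i\infty}^{r+i\infty}\frac{\Gamma(1-s)^2\,\Gamma(s)^2}{\Gamma(n_t-s)\,\Gamma(1+s)}\,z^s\,ds .$$ -/

import Mathlib

open MeasureTheory Set
open scoped Matrix MatrixOrder ComplexOrder

/-- Complex matrices carry the product sigma-algebra of their entries. -/
noncomputable instance instMeasurableSpaceComplexMatrix (m n : ℕ) :
    MeasurableSpace (Matrix (Fin m) (Fin n) ℂ) :=
  inferInstanceAs (MeasurableSpace (Fin m → Fin n → ℂ))

/-- The product sigma-algebra on complex matrices is the Borel sigma-algebra. -/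
instance instBorelSpaceComplexMatrix (m n : ℕ) :
    BorelSpace (Matrix (Fin m) (Fin n) ℂ) :=
  inferInstanceAs (BorelSpace (Fin m → Fin n → ℂ))

/-- The unitary group is compact: it is closed and its entries are bounded by one. -/
instance instCompactSpaceUnitaryGroup (n : ℕ) :
    CompactSpace (Matrix.unitaryGroup (Fin n) ℂ) := by
  have hclosed : IsClosed ((Matrix.unitaryGroup (Fin n) ℂ : Set (Matrix (Fin n) (Fin n) ℂ))) := by
    have h : (Matrix.unitaryGroup (Fin n) ℂ : Set (Matrix (Fin n) (Fin n) ℂ))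
        = {A | star A * A = 1} := by
      ext A
      exact Matrix.mem_unitaryGroup_iff'
    rw [h]
    exact isClosed_eq (by fun_prop) continuous_const
  have hK : IsCompact (Set.pi Set.univ (fun _ : Fin n =>
      Set.pi Set.univ (fun _ : Fin n => Metric.closedBall (0 : ℂ) 1))) :=
    isCompact_univ_pi fun _ => isCompact_univ_pi fun _ => isCompact_closedBall 0 1
  refine isCompact_iff_compactSpace.mp (hK.of_isClosed_subset hclosed ?_)
  intro A hA i _ j _
  have h1 := entry_norm_bound_of_unitary hA i j
  simpa using h1

/-- Haar probability measure on the unitary group `U(n)`. -/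
noncomputable def haarUnitary (n : ℕ) : Measure (Matrix.unitaryGroup (Fin n) ℂ) :=
  Measure.haarMeasure ⊤

/-- The function
`p(Λ) = (1/n!) ∏_{k > l} (λ_k - λ_l) det[q_b(λ_a)]_{a,b}` (with `b = 0, …, n-1`). -/
noncomputable def eigenvalueDensity {n : ℕ} (q : Fin n → ℝ → ℝ) (lam : Fin n → ℝ) : ℝ :=
  (1 / (n.factorial : ℝ)) * (∏ l : Fin n, ∏ k ∈ Finset.Ioi l, (lam k - lam l)) *
    (Matrix.of fun a b : Fin n => q b (lam a)).det

/-- The open positive orthant, in which the eigenvalues live. -/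
def positiveOrthant (n : ℕ) : Set (Fin n → ℝ) := {lam | ∀ i, 0 < lam i}

/-- The joint law of the (unordered) eigenvalues: density `eigenvalueDensity q` with respect to
Lebesgue measure on the positive orthant. -/
noncomputable def eigenvalueLaw {n : ℕ} (q : Fin n → ℝ → ℝ) : Measure (Fin n → ℝ) :=
  (volume.restrict (positiveOrthant n)).withDensity
    fun lam => ENNReal.ofReal (eigenvalueDensity q lam)

/-- The matrix `U† diag(λ) U`. -/
noncomputable def conjugateDiagonal {n : ℕ}
    (x : Matrix.unitaryGroup (Fin n) ℂ × (Fin n → ℝ)) : Matrix (Fin n) (Fin n) ℂ :=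
  (x.1 : Matrix (Fin n) (Fin n) ℂ)ᴴ * Matrix.diagonal (fun i => ((x.2 i : ℝ) : ℂ)) *
    (x.1 : Matrix (Fin n) (Fin n) ℂ)

/-- The random `m × n` matrix `P` is an invariant polynomial ensemble with monic polynomials
`p_0, …, p_{n-1}` and biorthonormal weights `q_0, …, q_{n-1}`: the matrix `P†P` is distributed
as `U† diag(λ) U` with `U` Haar distributed, independent of `λ`, and `λ` having the
joint density `eigenvalueDensity q` on the positive orthant. -/
structure IsInvariantPolynomialEnsemble {Ω : Type*} [MeasurableSpace Ω] (μ : Measure Ω)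
    {m n : ℕ} (P : Ω → Matrix (Fin m) (Fin n) ℂ)
    (p : Fin n → Polynomial ℝ) (q : Fin n → ℝ → ℝ) : Prop where
  aemeasurable : AEMeasurable P μ
  monic : ∀ j, (p j).Monic
  natDegree_eq : ∀ j, (p j).natDegree = (j : ℕ)
  integrable : ∀ a b, IntegrableOn (fun x => (p a).eval x * q b x) (Ioi 0)
  biorthonormal : ∀ a b, ∫ x in Ioi (0 : ℝ), (p a).eval x * q b x = if a = b then 1 else 0
  density_nonneg : ∀ᵐ lam ∂(volume.restrict (positiveOrthant n)), 0 ≤ eigenvalueDensity q lam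
  law : μ.map (fun ω => (P ω)ᴴ * P ω) =
    ((haarUnitary n).prod (eigenvalueLaw q)).map conjugateDiagonal

/-- The kernel `K(x, y) = ∑_j p_j(x) q_j(y)`. -/
noncomputable def polyKernel {n : ℕ} (p : Fin n → Polynomial ℝ) (q : Fin n → ℝ → ℝ)
    (x y : ℝ) : ℝ :=
  ∑ j : Fin n, (p j).eval x * q j y

/-- Output SINR of the `k`-th stream of the zero-forcing receiver:
`δ / [(H†H)⁻¹]_{kk}` (the diagonal of the Hermitian matrix `(H†H)⁻¹` is real). -/
noncomputable def zfSINR {m n : ℕ} (δ : ℝ) (H : Matrix (Fin m) (Fin n) ℂ) (k : Fin n) : ℝ :=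
  δ / (((Hᴴ * H)⁻¹) k k).re

/-- The ergodic sum rate `∑_k E[ln(1 + γ_k)]`. -/
noncomputable def sumRate {Ω : Type*} [MeasurableSpace Ω] (μ : Measure Ω) {n : ℕ}
    (γ : Fin n → Ω → ℝ) : ℝ :=
  ∑ k : Fin n, ∫ ω, Real.log (1 + γ k ω) ∂μ

/-- `σ_k = (Σ⁻¹)_{kk}` (real, since `Σ` is Hermitian). -/
noncomputable def invDiag {n : ℕ} (S : Matrix (Fin n) (Fin n) ℂ) (k : Fin n) : ℝ :=
  (S⁻¹ k k).re

/-- The Mellin-Barnes integrand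
`∏ Γ(c_j - s) ∏ Γ(1 - a_j + s) / (∏ Γ(b_j - s) ∏ Γ(1 - d_j + s)) x^s`. -/
noncomputable def meijerIntegrand (a b c d : List ℂ) (x s : ℂ) : ℂ :=
  ((c.map fun cj => Complex.Gamma (cj - s)).prod *
      (a.map fun aj => Complex.Gamma (1 - aj + s)).prod) /
    ((b.map fun bj => Complex.Gamma (bj - s)).prod *
      (d.map fun dj => Complex.Gamma (1 - dj + s)).prod) * x ^ s

/-- The vertical line `Re s = r` is an admissible contour: every pole `c_j + ℕ` of `Γ(c_j - s)`
lies to its right and every pole `a_j - 1 - ℕ` of `Γ(1 - a_j + s)` to its left. -/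
def IsMeijerAbscissa (a c : List ℂ) (r : ℝ) : Prop :=
  (∀ cj ∈ c, r < cj.re) ∧ ∀ aj ∈ a, aj.re - 1 < r

/-- The Meijer G-function `G(a; b | c; d | x)`, as the integral
`∫ ds / (2πi)` of `meijerIntegrand a b c d x` along the line `Re s = r`,
oriented from `r - i∞` to `r + i∞` (with `s = r + it`, `ds = i dt`).
To be used for `r` with `IsMeijerAbscissa a c r`. -/
noncomputable def meijerG (r : ℝ) (a b c d : List ℂ) (x : ℂ) : ℂ :=
  (1 / (2 * (Real.pi : ℂ))) * ∫ t : ℝ, meijerIntegrand a b c d x ((r : ℂ) + (t : ℂ) * Complex.I)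

/-- The claimed density
`(n-1) (σ/δ) ∫_0^1 K(0, σγx/δ) (1-x)^{n-2} x dx` of the zero-forcing SINR. -/
noncomputable def zfDensity (n : ℕ) (K : ℝ → ℝ → ℝ) (σ δ γ : ℝ) : ℝ :=
  ((n : ℝ) - 1) * (σ / δ) * ∫ x in (0 : ℝ)..1, K 0 (σ * γ * x / δ) * (1 - x) ^ (n - 2) * x

/-! Put n = n_t and let v be the k-th column of Σ_t^{-1/2}, so that ‖v‖² = σ_k. If P†P = U† diag(λ)
U, then [(H†H)⁻¹]_kk is the quadratic form Y = ∑ |(Uv)_i|²/λ_i, and γ/(γ+s) = 1/(1 + (s/δ)Y). The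
law of γ is found through the transform s ↦ E[(γ/(γ+s))^n]; the power n is chosen because it makes
the unitary average explicit.

A Gaussian integral over ℂⁿ computed in two ways (`integral_haarUnitary_resolvent`) shows that
averaging over U gives ∏ λ_i/(λ_i + σ_k s/δ). Andréief's identity, biorthonormality and Cramer's
rule (`integral_eigenvalueDensity_mul_prod`) then turn the average over λ into ∫ K(0,y) y/(y + σ_k
s/δ) dy.

The claimed density is a multiplicative convolution of K(0,·) with a beta weight, and an elementary
beta integral (`integral_beta_resolvent`) shows that it has the same transform. The transform
determines a finite measure on (0,∞) (`measure_ext_of_integral_resolvent`): its s-derivatives at s =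
1 yield all moments of the bounded injective function 1/(1+x). As the sign of the density is not
known beforehand, uniqueness is applied after its negative part has been moved to the other side
(`eq_withDensity_of_integral_resolvent`); nonnegativity is a by-product.

For the rate, Fubini moves the beta weight from the density onto ln(1+γ). Mellin inversion of
1/(1+v), followed by integration against du/u and then against the beta weight, identifies the
averaged logarithm with the Meijer G-function (`meijerG_eq`). -/

/-! ### Haar measure on the unitary group and its action on vectors -/

instance isHaarMeasure_haarUnitary (n : ℕ) : (haarUnitary n).IsHaarMeasure := by
  unfold haarUnitary; infer_instance

instance isProbabilityMeasure_haarUnitary (n : ℕ) : IsProbabilityMeasure (haarUnitary n) :=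
  ⟨by simpa [haarUnitary] using
    Measure.haarMeasure_self (K₀ := (⊤ : TopologicalSpace.PositiveCompacts
      (Matrix.unitaryGroup (Fin n) ℂ)))⟩

lemma map_mul_right_haarUnitary {n : ℕ} (g : Matrix.unitaryGroup (Fin n) ℂ) :
    (haarUnitary n).map (· * g) = haarUnitary n := by
  have : IsProbabilityMeasure ((haarUnitary n).map (· * g)) :=
    Measure.isProbabilityMeasure_map (measurable_mul_const g).aemeasurable
  exact Measure.isHaarMeasure_eq_of_isProbabilityMeasure _ _

/-- Sum of the squared moduli of the entries of a complex vector. -/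
noncomputable def sumNormSq {n : ℕ} (v : Fin n → ℂ) : ℝ := ∑ i, ‖v i‖ ^ 2

lemma sumNormSq_eq {n : ℕ} (v : Fin n → ℂ) : ((sumNormSq v : ℝ) : ℂ) = star v ⬝ᵥ v := by
  simp [sumNormSq, dotProduct, Complex.conj_mul']

lemma sumNormSq_nonneg {n : ℕ} (v : Fin n → ℂ) : 0 ≤ sumNormSq v :=
  Finset.sum_nonneg fun _ _ => by positivity

lemma sumNormSq_pos {n : ℕ} {v : Fin n → ℂ} (hv : v ≠ 0) : 0 < sumNormSq v := by
  obtain ⟨i, hi⟩ := Function.ne_iff.mp hv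
  exact Finset.sum_pos' (fun _ _ => by positivity)
    ⟨i, Finset.mem_univ i, by have := norm_pos_iff.mpr hi; positivity⟩

lemma sumNormSq_unitary {n : ℕ} (U : Matrix.unitaryGroup (Fin n) ℂ) (v : Fin n → ℂ) :
    sumNormSq ((U : Matrix (Fin n) (Fin n) ℂ) *ᵥ v) = sumNormSq v := by
  have h : (U : Matrix (Fin n) (Fin n) ℂ)ᴴ * U = 1 := Matrix.mem_unitaryGroup_iff'.mp U.2
  have : ((sumNormSq ((U : Matrix (Fin n) (Fin n) ℂ) *ᵥ v) : ℝ) : ℂ) = (sumNormSq v : ℝ) := by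
    rw [sumNormSq_eq, sumNormSq_eq, Matrix.star_mulVec, ← Matrix.dotProduct_mulVec,
      Matrix.mulVec_mulVec, h, Matrix.one_mulVec]
  exact_mod_cast this

lemma sumNormSq_smul {n : ℕ} (c : ℝ) (v : Fin n → ℂ) :
    sumNormSq ((c : ℂ) • v) = c ^ 2 * sumNormSq v := by
  simp [sumNormSq, mul_pow, Finset.mul_sum]

lemma exists_unitary_col {n : ℕ} (i₀ : Fin n) {v : Fin n → ℂ} (hv : sumNormSq v = 1) :
    ∃ V : Matrix.unitaryGroup (Fin n) ℂ,
      (V : Matrix (Fin n) (Fin n) ℂ) *ᵥ Pi.single i₀ 1 = v := by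
  have hn : ‖(WithLp.toLp 2 v : EuclideanSpace ℂ (Fin n))‖ = 1 := by
    rw [EuclideanSpace.norm_eq]; simpa [sumNormSq] using hv
  have ho : Orthonormal ℂ (({i₀} : Set (Fin n)).domRestrict
      fun _ : Fin n => (WithLp.toLp 2 v : EuclideanSpace ℂ (Fin n))) := by
    refine ⟨fun i => hn, fun i j hij => ?_⟩
    exact absurd (Subtype.ext (i.2.trans j.2.symm)) hij
  obtain ⟨b, hb⟩ := ho.exists_orthonormalBasis_extension_of_card_eq (by simp)
  refine ⟨⟨_, (EuclideanSpace.basisFun (Fin n) ℂ).toMatrix_orthonormalBasis_mem_unitary b⟩, ?_⟩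
  ext i
  rw [Matrix.mulVec_single_one]
  simp [Module.Basis.toMatrix, hb i₀ rfl]

/-- The unitary group is transitive on spheres: both vectors are normalised and each is written as
the image of the same basis vector. -/
lemma exists_unitary_mulVec {n : ℕ} {v w : Fin n → ℂ} (hv : v ≠ 0) (hw : w ≠ 0) :
    ∃ V : Matrix.unitaryGroup (Fin n) ℂ,
      w = ((√(sumNormSq w / sumNormSq v) : ℝ) : ℂ) • ((V : Matrix (Fin n) (Fin n) ℂ) *ᵥ v) := by
  obtain ⟨i₀, -⟩ := Function.ne_iff.mp hv
  have key : ∀ u : Fin n → ℂ, u ≠ 0 → ∃ V : Matrix.unitaryGroup (Fin n) ℂ,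
      u = ((√(sumNormSq u) : ℝ) : ℂ) • ((V : Matrix (Fin n) (Fin n) ℂ) *ᵥ Pi.single i₀ 1) := by
    intro u hu
    have hp := sumNormSq_pos hu
    have h1 : sumNormSq ((((√(sumNormSq u))⁻¹ : ℝ) : ℂ) • u) = 1 := by
      rw [sumNormSq_smul, inv_pow, Real.sq_sqrt hp.le, inv_mul_cancel₀ hp.ne']
    obtain ⟨V, hV⟩ := exists_unitary_col i₀ h1
    refine ⟨V, ?_⟩
    rw [hV, smul_smul, ← Complex.ofReal_mul, mul_inv_cancel₀ (Real.sqrt_pos.mpr hp).ne']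
    simp
  obtain ⟨V, hV⟩ := key v hv
  obtain ⟨W, hW⟩ := key w hw
  have hvp := Real.sqrt_pos.mpr (sumNormSq_pos hv)
  refine ⟨W * V⁻¹, ?_⟩
  have h : (V : Matrix (Fin n) (Fin n) ℂ)ᴴ * V = 1 := Matrix.mem_unitaryGroup_iff'.mp V.2
  have h2 : ((W * V⁻¹ : Matrix.unitaryGroup (Fin n) ℂ) : Matrix (Fin n) (Fin n) ℂ) *ᵥ v
      = ((√(sumNormSq v) : ℝ) : ℂ) • ((W : Matrix (Fin n) (Fin n) ℂ) *ᵥ Pi.single i₀ 1) := by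
    conv_lhs => rw [hV]
    rw [Matrix.mulVec_smul, Matrix.mulVec_mulVec]
    congr 2
    rw [show ((W * V⁻¹ : Matrix.unitaryGroup (Fin n) ℂ) : Matrix (Fin n) (Fin n) ℂ)
      = (W : Matrix (Fin n) (Fin n) ℂ) * (V : Matrix (Fin n) (Fin n) ℂ)ᴴ from rfl,
      mul_assoc, h, mul_one]
  rw [h2, smul_smul, ← Complex.ofReal_mul, Real.sqrt_div (sumNormSq_nonneg w),
    div_mul_cancel₀ _ hvp.ne']
  exact hW

/-! ### Gaussian integrals on ℂⁿ and the unitary average -/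

/-- A non-integrable function has Bochner integral 0, whereas the Gaussian formula gives a positive
value. -/
lemma integrable_exp_neg_mul_norm_sq {b : ℝ} (hb : 0 < b) :
    Integrable fun z : ℂ => Real.exp (-b * ‖z‖ ^ 2) := by
  by_contra h
  have h1 := GaussianFourier.integral_rexp_neg_mul_sq_norm (V := ℂ) hb
  rw [integral_undef h] at h1
  have : (0 : ℝ) < (Real.pi / b) ^ (Module.finrank ℝ ℂ / 2 : ℝ) := by positivity
  linarith

lemma integral_exp_neg_mul_norm_sq {b : ℝ} (hb : 0 < b) :
    ∫ z : ℂ, Real.exp (-b * ‖z‖ ^ 2) = Real.pi / b := by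
  rw [GaussianFourier.integral_rexp_neg_mul_sq_norm hb]
  simp [Complex.finrank_real_complex]

lemma exp_neg_sum {n : ℕ} (b : Fin n → ℝ) (x : Fin n → ℂ) :
    Real.exp (-∑ i, b i * ‖x i‖ ^ 2) = ∏ i, Real.exp (-b i * ‖x i‖ ^ 2) := by
  rw [← Real.exp_sum]; simp

lemma integrable_exp_neg_sum {n : ℕ} {b : Fin n → ℝ} (hb : ∀ i, 0 < b i) :
    Integrable fun x : Fin n → ℂ => Real.exp (-∑ i, b i * ‖x i‖ ^ 2) := by
  simp_rw [exp_neg_sum]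
  exact Integrable.fintype_prod fun i => integrable_exp_neg_mul_norm_sq (hb i)

lemma integral_exp_neg_sum {n : ℕ} {b : Fin n → ℝ} (hb : ∀ i, 0 < b i) :
    ∫ x : Fin n → ℂ, Real.exp (-∑ i, b i * ‖x i‖ ^ 2) = ∏ i, Real.pi / b i := by
  simp_rw [exp_neg_sum]
  rw [integral_fintype_prod_volume_eq_prod (f := fun i z => Real.exp (-b i * ‖z‖ ^ 2))]
  exact Finset.prod_congr rfl fun i _ => integral_exp_neg_mul_norm_sq (hb i)

/-- The real determinant of a complex linear map is the squared modulus of its complex determinant,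
here 1. -/
lemma measurePreserving_unitary {n : ℕ} (U : Matrix.unitaryGroup (Fin n) ℂ) :
    MeasurePreserving (fun x : Fin n → ℂ => (U : Matrix (Fin n) (Fin n) ℂ) *ᵥ x) := by
  set f : (Fin n → ℂ) →ₗ[ℂ] (Fin n → ℂ) := Matrix.toLin' (U : Matrix (Fin n) (Fin n) ℂ) with hf
  have hdet : ‖LinearMap.det f‖ = 1 := by
    rw [hf, LinearMap.det_toLin']
    exact CStarRing.norm_of_mem_unitary (Matrix.det_of_mem_unitary U.2)
  have hd : |LinearMap.det (f.restrictScalars ℝ)| = 1 := by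
    rw [LinearMap.det_restrictScalars, Algebra.norm_complex_apply, Complex.normSq_eq_norm_sq, hdet]
    simp
  have h0 : LinearMap.det (f.restrictScalars ℝ) ≠ 0 := by
    intro h; rw [h] at hd; simp at hd
  have := Measure.map_linearMap_addHaar_eq_smul_addHaar (volume : Measure (Fin n → ℂ)) h0
  refine ⟨by fun_prop, ?_⟩
  rw [abs_inv, hd] at this
  rw [ENNReal.ofReal_eq_one.mpr (by norm_num), one_smul] at this
  exact this

/-- Expectation of the resolvent power of a quadratic form at a uniformly rotated vector. -/
lemma integral_haarUnitary_resolvent {n : ℕ} {v : Fin n → ℂ} (hv : v ≠ 0) {a : Fin n → ℝ}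
    (ha : ∀ i, 0 ≤ a i) :
    ∫ U, (1 / (1 + ∑ i, a i * ‖((U : Matrix (Fin n) (Fin n) ℂ) *ᵥ v) i‖ ^ 2)) ^ n
      ∂(haarUnitary n) = ∏ i, 1 / (1 + sumNormSq v * a i) := by
  set τ := sumNormSq v with hτ
  have hτp : 0 < τ := sumNormSq_pos hv
  -- With this choice Q(Uv) = τ(1 + ∑ a_i |(Uv)_i|²), because ‖Uv‖² = τ. The integral of exp(-Q(Ux))
  -- over both x and U is evaluated in either order.
  set b : Fin n → ℝ := fun i => 1 + τ * a i with hb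
  have hbp : ∀ i, 1 ≤ b i := fun i => by have := mul_nonneg hτp.le (ha i); simp only [hb]; linarith
  have hbp' : ∀ i, 0 < b i := fun i => by linarith [hbp i]
  set Q : (Fin n → ℂ) → ℝ := fun x => ∑ i, b i * ‖x i‖ ^ 2 with hQ
  have hQc : Continuous Q := by fun_prop
  have hQge : ∀ x, sumNormSq x ≤ Q x := fun x =>
    Finset.sum_le_sum fun i _ => le_mul_of_one_le_left (by positivity) (hbp i)
  let F : (Matrix.unitaryGroup (Fin n) ℂ) → (Fin n → ℂ) → ℝ := fun U x =>
    Real.exp (-Q ((U : Matrix (Fin n) (Fin n) ℂ) *ᵥ x))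
  have hFc : Continuous (Function.uncurry F) := by
    refine Real.continuous_exp.comp (hQc.comp ?_).neg
    exact (continuous_subtype_val.comp continuous_fst).matrix_mulVec continuous_snd
  have hg : Integrable fun x : Fin n → ℂ => Real.exp (-sumNormSq x) := by
    simpa [sumNormSq] using integrable_exp_neg_sum (n := n) (b := fun _ => 1) (fun _ => one_pos)
  have hFi : Integrable (Function.uncurry F) ((haarUnitary n).prod volume) := by
    refine Integrable.mono' (hg.comp_snd (haarUnitary n)) hFc.aestronglyMeasurable ?_
    filter_upwards with z
    simp only [Function.uncurry, F, Real.norm_eq_abs, Real.abs_exp]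
    refine Real.exp_le_exp.mpr (neg_le_neg ?_)
    rw [← sumNormSq_unitary z.1 z.2]
    exact hQge _
  have h1 : ∀ U, ∫ x, F U x = ∏ i, Real.pi / b i := by
    intro U
    rw [← integral_exp_neg_sum hbp']
    have hm := (measurePreserving_unitary U).map_eq
    conv_rhs => rw [← hm]
    rw [integral_map (measurePreserving_unitary U).measurable.aemeasurable]
    exact (Real.continuous_exp.comp hQc.neg).aestronglyMeasurable
  -- After averaging over U, right invariance allows x to be replaced by v rescaled to the length of
  -- x. Then x enters only through its norm.
  let G : (Fin n → ℂ) → (Matrix.unitaryGroup (Fin n) ℂ) → ℝ := fun x U =>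
    Real.exp (-(sumNormSq x / τ * Q ((U : Matrix (Fin n) (Fin n) ℂ) *ᵥ v)))
  have h2 : ∀ x : Fin n → ℂ, x ≠ 0 → ∫ U, F U x ∂(haarUnitary n) = ∫ U, G x U ∂(haarUnitary n) := by
    intro x hx
    obtain ⟨V, hV⟩ := exists_unitary_mulVec hv hx
    have hc : Continuous fun U : Matrix.unitaryGroup (Fin n) ℂ => G x U :=
      Real.continuous_exp.comp (continuous_const.mul (hQc.comp
        (continuous_subtype_val.matrix_mulVec continuous_const))).neg
    conv_rhs => rw [← map_mul_right_haarUnitary V]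
    rw [integral_map (measurable_mul_const V).aemeasurable hc.aestronglyMeasurable]
    refine integral_congr_ae (Filter.Eventually.of_forall fun U => ?_)
    simp only [F, G]
    congr 2
    conv_lhs => rw [hV]
    have : ((U * V : Matrix.unitaryGroup (Fin n) ℂ) : Matrix (Fin n) (Fin n) ℂ) *ᵥ v
      = (U : Matrix (Fin n) (Fin n) ℂ) *ᵥ ((V : Matrix (Fin n) (Fin n) ℂ) *ᵥ v) := by
      rw [Matrix.mulVec_mulVec]; rfl
    rw [this, Matrix.mulVec_smul]
    simp only [hQ, Pi.smul_apply, smul_eq_mul, norm_mul, Complex.norm_real, mul_pow, sq_abs,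
      Real.norm_eq_abs, Finset.mul_sum]
    refine Finset.sum_congr rfl fun i _ => ?_
    rw [Real.sq_sqrt (div_nonneg (sumNormSq_nonneg x) hτp.le)]
    ring
  obtain ⟨i₀, -⟩ := Function.ne_iff.mp hv
  have hae : ∀ᵐ x : Fin n → ℂ, x ≠ 0 := by
    have : Nonempty (Fin n) := ⟨i₀⟩
    exact Measure.ae_ne volume 0
  have h3 : ∫ x, ∫ U, F U x ∂(haarUnitary n) = ∫ x, ∫ U, G x U ∂(haarUnitary n) :=
    integral_congr_ae (by filter_upwards [hae] with x hx using h2 x hx)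
  have hQv : ∀ U : Matrix.unitaryGroup (Fin n) ℂ,
      τ ≤ Q ((U : Matrix (Fin n) (Fin n) ℂ) *ᵥ v) := fun U => by
    have := hQge ((U : Matrix (Fin n) (Fin n) ℂ) *ᵥ v)
    rwa [sumNormSq_unitary] at this
  have hGi : Integrable (Function.uncurry G) (volume.prod (haarUnitary n)) := by
    refine Integrable.mono' (hg.comp_fst (haarUnitary n)) ?_ ?_
    · have : Continuous (Function.uncurry G) := by
        refine Real.continuous_exp.comp (((Continuous.div_const ?_ τ).mul (hQc.comp
          ((continuous_subtype_val.comp continuous_snd).matrix_mulVec continuous_const))).neg)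
        unfold sumNormSq
        fun_prop
      exact this.aestronglyMeasurable
    · filter_upwards with z
      simp only [Function.uncurry, G, Real.norm_eq_abs, Real.abs_exp]
      refine Real.exp_le_exp.mpr (neg_le_neg ?_)
      rw [div_mul_eq_mul_div, le_div_iff₀ hτp]
      exact mul_le_mul_of_nonneg_left (hQv z.2) (sumNormSq_nonneg _)
  -- For fixed U this is an isotropic Gaussian on ℂⁿ; the complex dimension n is the source of the
  -- n-th power.
  have h4 : ∀ U, ∫ x, G x U = (Real.pi / (Q ((U : Matrix (Fin n) (Fin n) ℂ) *ᵥ v) / τ)) ^ n := by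
    intro U
    have hp : 0 < Q ((U : Matrix (Fin n) (Fin n) ℂ) *ᵥ v) / τ :=
      div_pos (hτp.trans_le (hQv U)) hτp
    have := integral_exp_neg_sum (n := n) (fun _ => hp)
    rw [Finset.prod_const, Finset.card_fin] at this
    rw [← this]
    refine integral_congr_ae (Filter.Eventually.of_forall fun x => ?_)
    simp only [G, sumNormSq]
    rw [← Finset.mul_sum]
    congr 2
    ring
  have h5 : ∫ U, ∫ x, F U x ∂(volume) ∂(haarUnitary n)
      = ∫ U, ∫ x, G x U ∂(volume) ∂(haarUnitary n) := by
    rw [integral_integral_swap hFi, h3, integral_integral_swap hGi]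
  simp_rw [h1, h4] at h5
  have h6 : ∀ U : Matrix.unitaryGroup (Fin n) ℂ,
      (Real.pi / (Q ((U : Matrix (Fin n) (Fin n) ℂ) *ᵥ v) / τ)) ^ n = Real.pi ^ n *
      (1 / (1 + ∑ i, a i * ‖((U : Matrix (Fin n) (Fin n) ℂ) *ᵥ v) i‖ ^ 2)) ^ n := by
    intro U
    rw [← mul_pow, mul_one_div]
    congr 2
    have h : Q ((U : Matrix (Fin n) (Fin n) ℂ) *ᵥ v) = τ *
        (1 + ∑ i, a i * ‖((U : Matrix (Fin n) (Fin n) ℂ) *ᵥ v) i‖ ^ 2) := by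
      have h0 := sumNormSq_unitary U v
      simp only [hQ, hb, add_mul, one_mul, Finset.sum_add_distrib, mul_add, mul_one,
        Finset.mul_sum]
      rw [hτ, ← h0]
      simp only [sumNormSq, mul_assoc]
    rw [h, mul_div_cancel_left₀ _ hτp.ne']
  simp_rw [h6] at h5
  rw [integral_const_mul, integral_const, probReal_univ, one_smul] at h5
  have hpi : (∏ i, Real.pi / b i) = Real.pi ^ n * ∏ i, 1 / b i := by
    simp_rw [← mul_one_div Real.pi]
    rw [Finset.prod_mul_distrib]; simp
  rw [hpi] at h5
  exact (mul_left_cancel₀ (by positivity) h5).symm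

/-! ### Andréief's identity and the eigenvalue average -/

lemma det_mul_det_eq_sum {n : ℕ} (f g : Fin n → ℝ → ℝ) (x : Fin n → ℝ) :
    (Matrix.of fun a b : Fin n => f b (x a)).det * (Matrix.of fun a b : Fin n => g b (x a)).det
      = ∑ σ : Equiv.Perm (Fin n), ∑ τ : Equiv.Perm (Fin n),
        ((Equiv.Perm.sign σ : ℤ) : ℝ) * ((Equiv.Perm.sign τ : ℤ) : ℝ) *
          ∏ a, (f (σ a) (x a) * g (τ a) (x a)) := by
  rw [← Matrix.det_transpose, ← Matrix.det_transpose (Matrix.of fun a b : Fin n => g b (x a)),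
    Matrix.det_apply', Matrix.det_apply', Finset.sum_mul_sum]
  refine Finset.sum_congr rfl fun σ _ => Finset.sum_congr rfl fun τ _ => ?_
  simp only [Matrix.transpose_apply, Matrix.of_apply, Finset.prod_mul_distrib]
  ring

/-- Andréief's identity. -/
lemma andreief {n : ℕ} (ν : Measure ℝ) [SigmaFinite ν] (f g : Fin n → ℝ → ℝ)
    (hfg : ∀ a b, Integrable (fun x => f a x * g b x) ν) :
    ∫ x, (Matrix.of fun a b : Fin n => f b (x a)).det *
        (Matrix.of fun a b : Fin n => g b (x a)).det ∂(Measure.pi fun _ : Fin n => ν)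
      = n.factorial * (Matrix.of fun a b : Fin n => ∫ x, f a x * g b x ∂ν).det := by
  simp_rw [det_mul_det_eq_sum]
  have hint : ∀ σ τ : Equiv.Perm (Fin n), Integrable (fun x : Fin n → ℝ =>
      ((Equiv.Perm.sign σ : ℤ) : ℝ) * ((Equiv.Perm.sign τ : ℤ) : ℝ) *
          ∏ a, (f (σ a) (x a) * g (τ a) (x a))) (Measure.pi fun _ : Fin n => ν) := fun σ τ =>
    (Integrable.fintype_prod fun a => hfg (σ a) (τ a)).const_mul _
  rw [integral_finsetSum _ fun σ _ => integrable_finsetSum _ fun τ _ => hint σ τ]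
  have h1 : ∀ σ : Equiv.Perm (Fin n), ∫ x : Fin n → ℝ, ∑ τ : Equiv.Perm (Fin n),
      ((Equiv.Perm.sign σ : ℤ) : ℝ) * ((Equiv.Perm.sign τ : ℤ) : ℝ) *
          ∏ a, (f (σ a) (x a) * g (τ a) (x a)) ∂(Measure.pi fun _ : Fin n => ν)
      = (Matrix.of fun a b : Fin n => ∫ x, f a x * g b x ∂ν).det := by
    intro σ
    rw [integral_finsetSum _ fun τ _ => hint σ τ]
    -- Permuting the rows by σ costs a sign which cancels the sign of σ, so all n! permutations σ
    -- contribute the same determinant.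
    have h2 : (Matrix.of fun a b : Fin n => ∫ x, f a x * g b x ∂ν).det =
        ((Equiv.Perm.sign σ : ℤ) : ℝ) *
        ((Matrix.of fun a b : Fin n => ∫ x, f a x * g b x ∂ν).submatrix σ id).det := by
      rw [Matrix.det_permute, ← mul_assoc]
      norm_cast
      simp [Int.units_mul_self]
    rw [h2, ← Matrix.det_transpose, Matrix.det_apply', Finset.mul_sum]
    refine Finset.sum_congr rfl fun τ _ => ?_
    rw [integral_const_mul, mul_assoc,
      integral_fintype_prod_eq_prod (f := fun a x => f (σ a) x * g (τ a) x)]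
    simp
  simp_rw [h1]
  simp [Fintype.card_perm]

lemma measure_restrict_positiveOrthant (n : ℕ) :
    (volume : Measure (Fin n → ℝ)).restrict (positiveOrthant n) =
      Measure.pi fun _ : Fin n => (volume : Measure ℝ).restrict (Ioi 0) := by
  have : positiveOrthant n = Set.pi Set.univ fun _ => Ioi (0 : ℝ) := by
    ext; simp [positiveOrthant]
  rw [this, volume_pi, Measure.restrict_pi_pi]

lemma eval_eq_sum_coeff {n : ℕ} {P : Polynomial ℝ} (h : P.natDegree < n) (x : ℝ) :
    P.eval x = ∑ i : Fin n, P.coeff i * x ^ (i : ℕ) := by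
  rw [Polynomial.eval_eq_sum_range' h, Finset.sum_range]

/-- A monic polynomial of degree a is x^a plus lower powers, so integrability passes from the
polynomials to the monomials by strong induction. -/
lemma integrableOn_pow_mul_of_monic {n : ℕ} {p : Fin n → Polynomial ℝ} {g : ℝ → ℝ}
    (hm : ∀ j, (p j).Monic) (hd : ∀ j, (p j).natDegree = (j : ℕ))
    (hi : ∀ a, IntegrableOn (fun x => (p a).eval x * g x) (Ioi 0)) :
    ∀ a < n, IntegrableOn (fun x => x ^ a * g x) (Ioi 0) := by
  intro a
  induction a using Nat.strong_induction_on with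
  | _ a ih =>
    intro ha
    have h1 := hi ⟨a, ha⟩
    have h2 : IntegrableOn (fun x => ∑ i ∈ Finset.range a, (p ⟨a, ha⟩).coeff i * (x ^ i * g x))
        (Ioi 0) :=
      integrable_finsetSum _ fun i hi => (ih i (Finset.mem_range.mp hi)
        ((Finset.mem_range.mp hi).trans ha)).const_mul _
    refine (h1.sub h2).congr (Filter.Eventually.of_forall fun x => ?_)
    have h3 : (p ⟨a, ha⟩).coeff a = 1 := by
      have := (hm ⟨a, ha⟩).coeff_natDegree
      rwa [hd] at this
    simp only [Pi.sub_apply]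
    rw [Polynomial.eval_eq_sum_range, hd, Finset.sum_range_succ, h3, add_mul, Finset.sum_mul]
    simp [mul_assoc]

/-- The product is absorbed into the rows of the Vandermonde determinant, and Andréief leaves det M
for the moments M of w(x) = x/(x+s). Since w x^{i+1} = x^{i+1} - s w x^i, row operations replace
every row of M except the first by the corresponding row of the unweighted moment matrix C.
Biorthonormality says that the coefficient matrix A of the polynomials inverts C, so Cramer's rule
expands along the first row with coefficients p_j(0). This produces K(0,·). -/
lemma integral_eigenvalueDensity_mul_prod {n : ℕ} (hn : n ≠ 0) {p : Fin n → Polynomial ℝ}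
    {q : Fin n → ℝ → ℝ} (hm : ∀ j, (p j).Monic) (hd : ∀ j, (p j).natDegree = (j : ℕ))
    (hi : ∀ a b, IntegrableOn (fun x => (p a).eval x * q b x) (Ioi 0))
    (hb : ∀ a b, ∫ x in Ioi (0 : ℝ), (p a).eval x * q b x = if a = b then 1 else 0)
    {s : ℝ} (hs : 0 ≤ s) :
    ∫ lam in positiveOrthant n, eigenvalueDensity q lam * ∏ i, (lam i / (lam i + s)) =
      ∫ x in Ioi (0 : ℝ), polyKernel p q 0 x * (x / (x + s)) := by
  obtain ⟨m, rfl⟩ := Nat.exists_eq_succ_of_ne_zero hn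
  set w : ℝ → ℝ := fun x => x / (x + s) with hw
  have hwm : Measurable w := by fun_prop
  have hwb : ∀ x ∈ Ioi (0 : ℝ), ‖w x‖ ≤ 1 := fun x hx => by
    have hx : 0 < x := hx
    rw [Real.norm_of_nonneg (by positivity)]
    exact div_le_one_of_le₀ (by linarith) (by linarith)
  have hpow : ∀ (a b : Fin (m + 1)), IntegrableOn (fun x => x ^ (a : ℕ) * q b x) (Ioi 0) :=
    fun a b => integrableOn_pow_mul_of_monic hm hd (fun a => hi a b) a a.2
  have hwint : ∀ {g : ℝ → ℝ}, IntegrableOn g (Ioi 0) → IntegrableOn (fun x => w x * g x) (Ioi 0) :=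
    fun hg => hg.bdd_mul (c := 1) hwm.aestronglyMeasurable
      ((ae_restrict_iff' measurableSet_Ioi).mpr (Filter.Eventually.of_forall hwb))
  set f : Fin (m + 1) → ℝ → ℝ := fun a x => w x * x ^ (a : ℕ) with hf
  have hfq : ∀ a b, IntegrableOn (fun x => f a x * q b x) (Ioi 0) := fun a b => by
    simpa only [hf, mul_assoc] using hwint (hpow a b)
  have h1 : ∀ lam : Fin (m + 1) → ℝ, eigenvalueDensity q lam * ∏ i, (lam i / (lam i + s)) =
      (1 / ((m + 1).factorial : ℝ)) * ((Matrix.of fun a b : Fin (m + 1) => f b (lam a)).det *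
        (Matrix.of fun a b : Fin (m + 1) => q b (lam a)).det) := by
    intro lam
    have := Matrix.det_mul_column (fun i => w (lam i)) (Matrix.vandermonde lam)
    rw [Matrix.det_vandermonde] at this
    simp only [Matrix.vandermonde_apply] at this
    rw [show (Matrix.of fun a b : Fin (m + 1) => f b (lam a)).det = _ from this, eigenvalueDensity]
    simp only [hw]
    ring
  simp_rw [h1]
  rw [integral_const_mul, measure_restrict_positiveOrthant, andreief _ f q hfq, ← mul_assoc,
    one_div, inv_mul_cancel₀ (by positivity), one_mul]
  set M : Matrix (Fin (m + 1)) (Fin (m + 1)) ℝ :=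
    Matrix.of fun a b => ∫ x in Ioi (0 : ℝ), f a x * q b x with hM
  set C : Matrix (Fin (m + 1)) (Fin (m + 1)) ℝ :=
    Matrix.of fun a b => ∫ x in Ioi (0 : ℝ), x ^ (a : ℕ) * q b x with hC
  set A : Matrix (Fin (m + 1)) (Fin (m + 1)) ℝ := Matrix.of fun a b => (p a).coeff b with hA
  have hAC : A * C = 1 := by
    ext j b
    rw [Matrix.mul_apply, Matrix.one_apply, ← hb j b]
    simp only [hA, hC, Matrix.of_apply]
    simp_rw [← integral_const_mul]
    rw [← integral_finsetSum _ fun i _ => (hpow i b).const_mul _]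
    refine integral_congr_ae (Filter.Eventually.of_forall fun x => ?_)
    simp only
    rw [eval_eq_sum_coeff (n := m + 1) (by rw [hd]; exact j.2), Finset.sum_mul]
    simp [mul_assoc]
  -- A is lower triangular with unit diagonal, as p_j is monic of degree j.
  have hdetA : A.det = 1 := by
    rw [Matrix.det_of_isLowerTriangular]
    · refine Finset.prod_eq_one fun i _ => ?_
      have := (hm i).coeff_natDegree
      rwa [hd] at this
    · intro i j hij
      exact Polynomial.coeff_eq_zero_of_natDegree_lt (by rw [hd]; exact hij)
  have hdetC : C.det = 1 := by
    have := congrArg Matrix.det hAC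
    rwa [Matrix.det_mul, hdetA, one_mul, Matrix.det_one] at this
  have hCA : C * A = 1 := mul_eq_one_comm.mp hAC
  have hMC : M.det = (C.updateRow 0 (M 0)).det := by
    refine Matrix.det_eq_of_forall_row_eq_smul_add_pred (fun _ => -s) (fun j => by simp) ?_
    intro i j
    rw [Matrix.updateRow_ne (Fin.succ_ne_zero i)]
    simp only [hM, hC, Matrix.of_apply]
    rw [← integral_const_mul, ← integral_add (hpow _ _) ((hfq _ _).const_mul _)]
    refine setIntegral_congr_fun measurableSet_Ioi fun x hx => ?_
    have hx : 0 < x := hx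
    simp only [hf, hw, Fin.val_succ, Fin.val_castSucc]
    field_simp
    ring
  have hcr : Cᵀ.cramer (M 0) = Aᵀ *ᵥ (M 0) := by
    have h2 := Matrix.mulVec_cramer Cᵀ (M 0)
    rw [Matrix.det_transpose, hdetC, one_smul] at h2
    have h3 := congrArg (Aᵀ *ᵥ ·) h2
    simp only [Matrix.mulVec_mulVec, ← Matrix.transpose_mul, hCA, Matrix.transpose_one,
      Matrix.one_mulVec] at h3
    exact h3
  rw [hMC, ← Matrix.cramer_transpose_apply, hcr]
  simp only [Matrix.mulVec, dotProduct, Matrix.transpose_apply, hA, hM, Matrix.of_apply]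
  simp_rw [← integral_const_mul]
  rw [← integral_finsetSum _ fun i _ => (hfq _ _).const_mul _]
  refine integral_congr_ae (Filter.Eventually.of_forall fun x => ?_)
  simp only [polyKernel, Finset.sum_mul, ← Polynomial.coeff_zero_eq_eval_zero, hf, hw]
  refine Finset.sum_congr rfl fun i _ => ?_
  simp
  ring

/-! ### Measures on the half line determined by resolvent powers -/

open scoped BoundedContinuousFunction in
/-- Finite measures with the same moments of an injective bounded continuous function coincide. -/
lemma ext_of_forall_integral_pow {E : Type*} [TopologicalSpace E] [PolishSpace E]
    [MeasurableSpace E] [BorelSpace E] {P Q : Measure E} [IsFiniteMeasure P] [IsFiniteMeasure Q]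
    (e : E →ᵇ ℝ) (he : Function.Injective e)
    (h : ∀ m : ℕ, ∫ x, e x ^ m ∂P = ∫ x, e x ^ m ∂Q) : P = Q := by
  -- Injectivity of e makes this algebra separate points, and its elements are polynomials in e,
  -- whose integrals are fixed by the moments.
  let A : StarSubalgebra ℝ (E →ᵇ ℝ) :=
    { Algebra.adjoin ℝ {e} with
      star_mem' := fun {a} ha => by
        have : star a = a := by ext x; simp
        rw [this]; exact ha }
  refine ext_of_forall_mem_subalgebra_integral_eq_of_polish (𝕜 := ℝ) (A := A) ?_ ?_
  · intro x y hxy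
    refine ⟨e, ⟨BoundedContinuousFunction.toContinuousMapStarₐ ℝ e,
      ⟨e, Algebra.subset_adjoin rfl, rfl⟩, rfl⟩, fun h => hxy (he h)⟩
  · intro g hg
    have hg : g ∈ Algebra.adjoin ℝ {e} := hg
    rw [Algebra.adjoin_singleton_eq_range_aeval] at hg
    obtain ⟨p, rfl⟩ := hg
    have h1 : ∀ x, (Polynomial.aeval e p) x
        = ∑ i ∈ Finset.range (p.natDegree + 1), p.coeff i * e x ^ i := by
      intro x
      rw [Polynomial.aeval_eq_sum_range]
      simp
    have hint : ∀ (R : Measure E) [IsFiniteMeasure R] (i : ℕ), Integrable (fun x => e x ^ i) R :=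
      fun R _ i => (e ^ i).integrable R
    simp only [AlgHom.toRingHom_eq_coe, RingHom.coe_coe, h1]
    rw [integral_finsetSum _ fun i _ => (hint P i).const_mul _,
      integral_finsetSum _ fun i _ => (hint Q i).const_mul _]
    simp_rw [integral_const_mul, h]

lemma injective_div_one_add_abs : Function.Injective fun x : ℝ => x / (1 + |x|) := by
  intro x y h
  have hx : 0 < 1 + |x| := by positivity
  have hy : 0 < 1 + |y| := by positivity
  simp only at h
  rw [div_eq_div_iff hx.ne' hy.ne'] at h
  rcases abs_cases x with ⟨h1, h2⟩ | ⟨h1, h2⟩ <;> rcases abs_cases y with ⟨h3, h4⟩ | ⟨h3, h4⟩ <;>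
    rw [h1, h3] at h <;> nlinarith

lemma ae_pos_of_measure_Iic_zero {α : Measure ℝ} (h : α (Iic 0) = 0) : ∀ᵐ x ∂α, 0 < x := by
  rw [ae_iff]
  convert h using 2
  ext; simp

lemma abs_pow_div_pow_le {n k : ℕ} (hk : n ≤ k) {x t r : ℝ} (hx : 0 < x) (hr : 0 < r)
    (ht : r ≤ t) : |x ^ n / (x + t) ^ k| ≤ (1 / r) ^ (k - n) := by
  have hxt : 0 < x + t := by linarith
  obtain ⟨d, rfl⟩ := Nat.exists_eq_add_of_le hk
  rw [abs_of_nonneg (by positivity), pow_add, ← div_div, ← div_pow, Nat.add_sub_cancel_left,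
    one_div_pow, ← mul_one_div]
  have h1 : (x / (x + t)) ^ n ≤ 1 := pow_le_one₀ (by positivity)
    (div_le_one_of_le₀ (by linarith) hxt.le)
  have h2 : 1 / (x + t) ^ d ≤ 1 / r ^ d :=
    one_div_le_one_div_of_le (by positivity) (pow_le_pow_left₀ hr.le (by linarith) d)
  calc _ ≤ 1 * (1 / (x + t) ^ d) := mul_le_mul_of_nonneg_right h1 (by positivity)
    _ ≤ _ := by rw [one_mul]; exact h2

/-- For x > 0 and t ≥ s/2 the differentiated integrand is bounded uniformly, thanks to n ≤ k. A
constant therefore dominates it on a neighbourhood of s. -/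
lemma hasDerivAt_integral_pow_div_pow {α : Measure ℝ} [IsFiniteMeasure α] (hα : α (Iic 0) = 0)
    {n k : ℕ} (hk : n ≤ k) {s : ℝ} (hs : 0 < s) :
    HasDerivAt (fun t => ∫ x, x ^ n / (x + t) ^ k ∂α)
      (∫ x, -(k * (x ^ n / (x + s) ^ (k + 1))) ∂α) s := by
  refine (hasDerivAt_integral_of_dominated_loc_of_deriv_le (μ := α)
    (F := fun t x => x ^ n / (x + t) ^ k)
    (F' := fun t x => -(k * (x ^ n / (x + t) ^ (k + 1))))
    (bound := fun _ => k * (1 / (s / 2)) ^ (k + 1 - n)) (s := Ioi (s / 2))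
    (Ioi_mem_nhds (by linarith)) ?_ ?_ ?_ ?_ (integrable_const _) ?_).2
  · exact Filter.Eventually.of_forall fun t => Measurable.aestronglyMeasurable (by fun_prop)
  · refine Integrable.of_bound (Measurable.aestronglyMeasurable (by fun_prop)) ((1 / s) ^ (k - n)) ?_
    filter_upwards [ae_pos_of_measure_Iic_zero hα] with x hx
    exact abs_pow_div_pow_le hk hx hs le_rfl
  · exact Measurable.aestronglyMeasurable (by fun_prop)
  · filter_upwards [ae_pos_of_measure_Iic_zero hα] with x hx t ht
    rw [norm_neg, norm_mul, Real.norm_natCast]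
    exact mul_le_mul_of_nonneg_left
      (abs_pow_div_pow_le (by omega) hx (by linarith) (le_of_lt ht)) (by positivity)
  · filter_upwards [ae_pos_of_measure_Iic_zero hα] with x hx t ht
    have ht : s / 2 < t := ht
    have hxt : x + t ≠ 0 := by linarith
    have h1 := ((((hasDerivAt_id t).const_add x).pow k).inv (pow_ne_zero k hxt)).const_mul (x ^ n)
    convert! h1 using 1
    rcases k with _ | k
    · simp
    · simp only [id, Nat.add_sub_cancel, Pi.pow_apply]
      field_simp
      ring

/-- Differentiating m times in s gives equality of the integrals of x^n/(x+s)^{n+m}. At s = 1 these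
are the moments of 1/(1+x) under the weight (x/(1+x))^n. The weight is positive on the half line,
hence can be divided out. -/
lemma measure_ext_of_integral_resolvent {α β : Measure ℝ} [IsFiniteMeasure α] [IsFiniteMeasure β]
    (hα : α (Iic 0) = 0) (hβ : β (Iic 0) = 0) {n : ℕ} (hn : n ≠ 0)
    (h : ∀ s : ℝ, 0 < s → ∫ x, (x / (x + s)) ^ n ∂α = ∫ x, (x / (x + s)) ^ n ∂β) : α = β := by
  have h1 : ∀ m : ℕ, ∀ s : ℝ, 0 < s →
      ∫ x, x ^ n / (x + s) ^ (n + m) ∂α = ∫ x, x ^ n / (x + s) ^ (n + m) ∂β := by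
    intro m
    induction m with
    | zero => intro s hs; simpa only [div_pow, add_zero] using h s hs
    | succ m ih =>
      intro s hs
      have d1 := hasDerivAt_integral_pow_div_pow hα (Nat.le_add_right n m) hs
      have d2 := hasDerivAt_integral_pow_div_pow hβ (Nat.le_add_right n m) hs
      have d3 := d1.congr_of_eventuallyEq (f₁ := fun t => ∫ x, x ^ n / (x + t) ^ (n + m) ∂β)
        (by filter_upwards [Ioi_mem_nhds hs] with t ht using (ih t ht).symm)
      have h2 := d3.unique d2
      rw [integral_neg, integral_neg, integral_const_mul, integral_const_mul, neg_inj] at h2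
      exact mul_left_cancel₀ (by positivity) h2
  -- An injective bounded continuous function on all of ℝ that equals 1/(1+x) for x > 0.
  let e : BoundedContinuousFunction ℝ ℝ := BoundedContinuousFunction.ofNormedAddCommGroup
    (fun x : ℝ => 1 - x / (1 + |x|))
    (continuous_const.sub (continuous_id.div (by fun_prop) fun x => by positivity)) 2 (by
      intro x
      have h0 : |x / (1 + |x|)| ≤ 1 := by
        rw [abs_div, abs_of_pos (show 0 < 1 + |x| by positivity)]
        exact div_le_one_of_le₀ (by linarith) (by positivity)
      rw [Real.norm_eq_abs]
      exact (abs_sub _ _).trans (by rw [abs_one]; linarith))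
  have he : Function.Injective e := fun x y hxy =>
    injective_div_one_add_abs (sub_right_injective (b := (1 : ℝ)) hxy)
  let w : ℝ → ENNReal := fun x => ENNReal.ofReal ((|x| / (1 + |x|)) ^ n)
  have hwm : Measurable w := by fun_prop
  have hw0 : ∀ {γ : Measure ℝ}, γ (Iic 0) = 0 → ∀ᵐ x ∂γ, w x ≠ 0 := by
    intro γ hγ
    filter_upwards [ae_pos_of_measure_Iic_zero hγ] with x hx
    simp only [w, ne_eq, ENNReal.ofReal_eq_zero, not_le]
    have : 0 < |x| := abs_pos.mpr hx.ne'
    positivity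
  have hwt : ∀ x, w x ≠ ⊤ := fun x => ENNReal.ofReal_ne_top
  have hfin : ∀ (γ : Measure ℝ) [IsFiniteMeasure γ], IsFiniteMeasure (γ.withDensity w) := by
    intro γ _
    refine isFiniteMeasure_withDensity (ne_of_lt (lt_of_le_of_lt (lintegral_mono (g := 1) ?_) ?_))
    · intro x
      simp only [w, Pi.one_apply, ENNReal.ofReal_le_one]
      exact pow_le_one₀ (by positivity) (div_le_one_of_le₀ (by linarith) (by positivity))
    · simp
  have hmom : ∀ {γ : Measure ℝ}, γ (Iic 0) = 0 → ∀ m : ℕ,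
      ∫ x, e x ^ m ∂(γ.withDensity w) = ∫ x, x ^ n / (x + 1) ^ (n + m) ∂γ := by
    intro γ hγ m
    rw [integral_withDensity_eq_integral_toReal_smul hwm
      (Filter.Eventually.of_forall fun x => (hwt x).lt_top)]
    refine integral_congr_ae ?_
    filter_upwards [ae_pos_of_measure_Iic_zero hγ] with x hx
    have he' : e x = 1 / (x + 1) := by
      change 1 - x / (1 + |x|) = _
      rw [abs_of_pos hx]
      field_simp
      ring
    rw [he', ENNReal.toReal_ofReal (by positivity), abs_of_pos hx, smul_eq_mul, pow_add,
      div_pow, div_pow, one_pow, add_comm 1 x]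
    field_simp
  have := hfin α
  have := hfin β
  have key : α.withDensity w = β.withDensity w :=
    ext_of_forall_integral_pow e he fun m => by rw [hmom hα, hmom hβ, h1 m 1 one_pos]
  have h3 := withDensity_inv_same₀ hwm.aemeasurable (hw0 hα) (Filter.Eventually.of_forall hwt)
  have h4 := withDensity_inv_same₀ hwm.aemeasurable (hw0 hβ) (Filter.Eventually.of_forall hwt)
  rw [← h3, ← h4, key]

/-- A finite measure on the half line whose resolvent moments are given by an integrable
(a priori signed) density has that density, which is then nonnegative. -/
lemma eq_withDensity_of_integral_resolvent {ν : Measure ℝ} [IsFiniteMeasure ν]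
    (hν : ν (Iic 0) = 0) {ρ : ℝ → ℝ} (hρ : IntegrableOn ρ (Ioi 0)) {n : ℕ} (hn : n ≠ 0)
    (h : ∀ s : ℝ, 0 < s →
      ∫ x, (x / (x + s)) ^ n ∂ν = ∫ x in Ioi (0 : ℝ), ρ x * (x / (x + s)) ^ n) :
    (∀ᵐ x ∂(volume.restrict (Ioi (0 : ℝ))), 0 ≤ ρ x) ∧
      ν = (volume.restrict (Ioi 0)).withDensity fun x => ENNReal.ofReal (ρ x) := by
  set l : Measure ℝ := volume.restrict (Ioi 0) with hl
  have hl0 : l (Iic 0) = 0 := by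
    rw [hl, Measure.restrict_apply measurableSet_Iic, Iic_inter_Ioi, Ioc_self, measure_empty]
  have hf1 : IsFiniteMeasure (l.withDensity fun x => ENNReal.ofReal (ρ x)) :=
    isFiniteMeasure_withDensity_ofReal hρ.2
  have hf2 : IsFiniteMeasure (l.withDensity fun x => ENNReal.ofReal (-ρ x)) :=
    isFiniteMeasure_withDensity_ofReal hρ.neg.2
  have hac : ∀ f : ℝ → ENNReal, l.withDensity f (Iic 0) = 0 := fun f =>
    withDensity_absolutelyContinuous l f hl0
  have hbd : ∀ {γ : Measure ℝ}, γ (Iic 0) = 0 → ∀ s : ℝ, 0 < s →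
      ∀ᵐ x ∂γ, ‖(x / (x + s)) ^ n‖ ≤ 1 := by
    intro γ hγ s hs
    filter_upwards [ae_pos_of_measure_Iic_zero hγ] with x hx
    rw [Real.norm_of_nonneg (by positivity)]
    exact pow_le_one₀ (by positivity) (div_le_one_of_le₀ (by linarith) (by linarith))
  have hint : ∀ {γ : Measure ℝ} [IsFiniteMeasure γ], γ (Iic 0) = 0 → ∀ s : ℝ, 0 < s →
      Integrable (fun x => (x / (x + s)) ^ n) γ := by
    intro γ _ hγ s hs
    exact Integrable.of_bound (Measurable.aestronglyMeasurable (by fun_prop)) 1 (hbd hγ s hs)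
  have hwd : ∀ f : ℝ → ℝ, IntegrableOn f (Ioi 0) → ∀ s : ℝ,
      ∫ x, (x / (x + s)) ^ n ∂(l.withDensity fun x => ENNReal.ofReal (f x)) =
        ∫ x, max (f x) 0 * (x / (x + s)) ^ n ∂l := by
    intro f hf s
    rw [integral_withDensity_eq_integral_toReal_smul₀ hf.1.aemeasurable.ennreal_ofReal
      (Filter.Eventually.of_forall fun x => ENNReal.ofReal_lt_top)]
    simp only [ENNReal.toReal_ofReal', smul_eq_mul, hl]
  have hmul : ∀ f : ℝ → ℝ, IntegrableOn f (Ioi 0) → ∀ s : ℝ, 0 < s →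
      Integrable (fun x => f x * (x / (x + s)) ^ n) l := by
    intro f hf s hs
    exact hf.mul_bdd (c := 1) (Measurable.aestronglyMeasurable (by fun_prop)) (hbd hl0 s hs)
  -- Both sides are now positive measures, so uniqueness applies although the sign of ρ is still
  -- unknown.
  have key : ν + l.withDensity (fun x => ENNReal.ofReal (-ρ x))
      = l.withDensity fun x => ENNReal.ofReal (ρ x) := by
    refine measure_ext_of_integral_resolvent (by simp [hν, hac]) (hac _) hn fun s hs => ?_
    have hneg : IntegrableOn (fun x => -ρ x) (Ioi 0) := hρ.neg
    rw [integral_add_measure (hint hν s hs) (hint (hac _) s hs), h s hs, hwd _ hρ,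
      hwd _ hneg, ← integral_add (hmul _ hρ s hs)
        (hmul (fun x => max (-ρ x) 0) (Integrable.pos_part hneg) s hs)]
    refine integral_congr_ae (Filter.Eventually.of_forall fun x => ?_)
    simp only
    rw [← add_mul]
    congr 1
    rcases le_total (ρ x) 0 with h0 | h0
    · rw [max_eq_left (by linarith), max_eq_right h0]; ring
    · rw [max_eq_right (by linarith), max_eq_left h0]; ring
  -- The previous identity bounds the negative part of ρ by its positive part; as they are never
  -- both nonzero, the negative part vanishes.
  have hle : ∀ᵐ x ∂l, ENNReal.ofReal (-ρ x) ≤ ENNReal.ofReal (ρ x) := by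
    refine ae_le_of_forall_setLIntegral_le_of_sigmaFinite₀ hρ.neg.1.aemeasurable.ennreal_ofReal ?_
    intro s hs _
    rw [← withDensity_apply _ hs, ← withDensity_apply _ hs, ← key, Measure.add_apply]
    exact le_add_self
  have hpos : ∀ᵐ x ∂l, 0 ≤ ρ x := by
    filter_upwards [hle] with x hx
    by_contra h0
    push Not at h0
    rw [ENNReal.ofReal_of_nonpos h0.le, nonpos_iff_eq_zero, ENNReal.ofReal_eq_zero] at hx
    linarith
  refine ⟨hpos, ?_⟩
  have hz : l.withDensity (fun x => ENNReal.ofReal (-ρ x)) = 0 := by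
    have hm : AEMeasurable (fun x => ENNReal.ofReal (-ρ x)) l :=
      hρ.neg.1.aemeasurable.ennreal_ofReal
    rw [withDensity_eq_zero_iff hm]
    filter_upwards [hpos] with x hx
    simpa using hx
  rw [← key, hz, add_zero]

/-! ### Multiplicative convolution and the candidate density -/

lemma ae_restrict_Ioc_comp_mul_left {K k : ℝ → ℝ}
    (h : K =ᵐ[volume.restrict (Ioi 0)] k) {a : ℝ} (ha : 0 < a) :
    ∀ᵐ x ∂(volume.restrict (Ioc (0 : ℝ) 1)), K (a * x) = k (a * x) := by
  have h1 : ∀ᵐ y : ℝ, y ∈ Ioi (0 : ℝ) → K y = k y := (ae_restrict_iff' measurableSet_Ioi).mp h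
  have h2 : ∀ᵐ x : ℝ, a * x ∈ Ioi (0 : ℝ) → K (a * x) = k (a * x) := by
    rw [ae_iff] at h1 ⊢
    have := Real.volume_preimage_mul_left ha.ne' {y | ¬ (y ∈ Ioi (0 : ℝ) → K y = k y)}
    rw [h1, mul_zero] at this
    exact this
  rw [ae_restrict_iff' measurableSet_Ioc]
  filter_upwards [h2] with x hx hx'
  exact hx (mul_pos ha hx'.1)

/-- For fixed x substitute y = cxγ: the Jacobian 1/(cx) cancels the factor x and leaves 1/c. The
rest is Fubini, whose hypothesis is carried through the same substitution. -/
lemma dilation_fubini_of_measurable {k w h : ℝ → ℝ} (hk : Measurable k) (hw : Measurable w)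
    (hh : Measurable h) {c : ℝ} (hc : 0 < c)
    (H : Integrable (fun z : ℝ × ℝ => k z.2 * w z.1 * h (z.2 / (c * z.1)))
      ((volume.restrict (Ioc 0 1)).prod (volume.restrict (Ioi 0)))) :
    IntegrableOn (fun γ => (∫ x in Ioc (0 : ℝ) 1, k (c * γ * x) * w x * x) * h γ) (Ioi 0) ∧
    c * ∫ γ in Ioi (0 : ℝ), (∫ x in Ioc (0 : ℝ) 1, k (c * γ * x) * w x * x) * h γ =
      ∫ y in Ioi (0 : ℝ), k y * ∫ x in Ioc (0 : ℝ) 1, w x * h (y / (c * x)) := by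
  let g : ℝ × ℝ → ℝ := fun z => k (c * z.2 * z.1) * w z.1 * z.1 * h z.2
  have hgm : Measurable g := by fun_prop
  have hcv : ∀ x ∈ Ioc (0 : ℝ) 1, ∀ γ : ℝ,
      g (x, γ) = x * (fun y => k y * w x * h (y / (c * x))) ((c * x) * γ) := by
    intro x hx γ
    have : c * x ≠ 0 := (mul_pos hc hx.1).ne'
    simp only [g]
    rw [mul_div_cancel_left₀ _ this, mul_right_comm c γ x]
    ring
  have hH := (integrable_prod_iff H.1).mp H
  have hmem : ∀ᵐ x ∂(volume.restrict (Ioc (0 : ℝ) 1)), x ∈ Ioc (0 : ℝ) 1 :=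
    ae_restrict_mem measurableSet_Ioc
  have hgi : Integrable g ((volume.restrict (Ioc 0 1)).prod (volume.restrict (Ioi 0))) := by
    refine (integrable_prod_iff hgm.aestronglyMeasurable).mpr ⟨?_, ?_⟩
    · filter_upwards [hH.1, hmem] with x hx hx'
      simp_rw [hcv x hx']
      refine Integrable.const_mul ?_ _
      have := (integrableOn_Ioi_comp_mul_left_iff (fun y => k y * w x * h (y / (c * x))) 0
        (mul_pos hc hx'.1)).mpr (by rw [mul_zero]; exact hx)
      exact this
    · refine (hH.2.const_mul c⁻¹).congr ?_
      filter_upwards [hmem] with x hx'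
      simp_rw [hcv x hx', norm_mul x]
      rw [integral_const_mul, integral_comp_mul_left_Ioi
        (fun y => ‖k y * w x * h (y / (c * x))‖) 0 (mul_pos hc hx'.1), mul_zero,
        Real.norm_of_nonneg hx'.1.le, smul_eq_mul, mul_inv, ← mul_assoc, mul_comm x, mul_assoc c⁻¹,
        inv_mul_cancel₀ hx'.1.ne', mul_one]
  refine ⟨?_, ?_⟩
  · refine hgi.integral_prod_right.congr (Filter.Eventually.of_forall fun γ => ?_)
    simp only [g]
    rw [integral_mul_const]
  · have h1 := integral_integral_swap (f := fun x γ => g (x, γ)) hgi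
    have h2 := integral_integral_swap (f := fun x y => k y * w x * h (y / (c * x))) H
    have h3 : ∫ γ in Ioi (0 : ℝ), ∫ x in Ioc (0 : ℝ) 1, g (x, γ)
        = ∫ γ in Ioi (0 : ℝ), (∫ x in Ioc (0 : ℝ) 1, k (c * γ * x) * w x * x) * h γ := by
      refine integral_congr_ae (Filter.Eventually.of_forall fun γ => ?_)
      simp only [g]
      rw [integral_mul_const]
    have h4 : ∫ y in Ioi (0 : ℝ), ∫ x in Ioc (0 : ℝ) 1, k y * w x * h (y / (c * x))
        = ∫ y in Ioi (0 : ℝ), k y * ∫ x in Ioc (0 : ℝ) 1, w x * h (y / (c * x)) := by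
      refine integral_congr_ae (Filter.Eventually.of_forall fun y => ?_)
      simp only [mul_assoc]
      rw [integral_const_mul]
    rw [← h3, ← h4, ← h1, ← h2, ← integral_const_mul]
    refine integral_congr_ae ?_
    filter_upwards [hmem] with x hx'
    simp_rw [hcv x hx']
    rw [integral_const_mul, integral_comp_mul_left_Ioi
        (fun y => k y * w x * h (y / (c * x))) 0 (mul_pos hc hx'.1), mul_zero, smul_eq_mul]
    have := hx'.1.ne'
    rw [mul_inv, ← mul_assoc, ← mul_assoc, mul_comm c, mul_assoc x, mul_inv_cancel_left₀ hc.ne',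
      mul_inv_cancel₀ this, one_mul]

/-- Integrating a function against a multiplicative convolution. -/
lemma dilation_fubini {K w h : ℝ → ℝ} (hK : AEMeasurable K (volume.restrict (Ioi 0)))
    (hw : Measurable w) (hh : Measurable h) {c : ℝ} (hc : 0 < c)
    (H : Integrable (fun z : ℝ × ℝ => K z.2 * w z.1 * h (z.2 / (c * z.1)))
      ((volume.restrict (Ioc 0 1)).prod (volume.restrict (Ioi 0)))) :
    IntegrableOn (fun γ => (∫ x in Ioc (0 : ℝ) 1, K (c * γ * x) * w x * x) * h γ) (Ioi 0) ∧
    c * ∫ γ in Ioi (0 : ℝ), (∫ x in Ioc (0 : ℝ) 1, K (c * γ * x) * w x * x) * h γ =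
      ∫ y in Ioi (0 : ℝ), K y * ∫ x in Ioc (0 : ℝ) 1, w x * h (y / (c * x)) := by
  have hKk := hK.ae_eq_mk
  have H' := H.congr (g := fun z : ℝ × ℝ => hK.mk K z.2 * w z.1 * h (z.2 / (c * z.1))) (by
    filter_upwards [Measure.quasiMeasurePreserving_snd.ae hKk] with z hz
    simp only [hz])
  obtain ⟨h1, h2⟩ := dilation_fubini_of_measurable hK.measurable_mk hw hh hc H'
  have h3 : ∀ γ ∈ Ioi (0 : ℝ), (∫ x in Ioc (0 : ℝ) 1, hK.mk K (c * γ * x) * w x * x) * h γ =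
      (∫ x in Ioc (0 : ℝ) 1, K (c * γ * x) * w x * x) * h γ := by
    intro γ hγ
    congr 1
    refine integral_congr_ae ?_
    filter_upwards [ae_restrict_Ioc_comp_mul_left hKk (mul_pos hc hγ)] with x hx
    rw [hx]
  refine ⟨(integrableOn_congr_fun h3 measurableSet_Ioi).mp h1, ?_⟩
  rw [← setIntegral_congr_fun measurableSet_Ioi h3, h2]
  refine integral_congr_ae ?_
  filter_upwards [hKk] with y hy
  rw [hy]

/-- The integrand is (1-x)^m (z/(z+sx))^{m+2}. The derivative of (1-x)/(z+sx) is -(z+s)/(z+sx)², so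
a power of this quotient is an explicit antiderivative. This needs the exponent to exceed m by
exactly 2, which is the relation between the weight (1-x)^{n-2} and the n-th resolvent power. -/
lemma integral_beta_resolvent (m : ℕ) {z s : ℝ} (hz : 0 < z) (hs : 0 < s) :
    ((m : ℝ) + 1) * ∫ x in Ioc (0 : ℝ) 1, (1 - x) ^ m * (z / x / (z / x + s)) ^ (m + 2) =
      z / (z + s) := by
  have hpos : ∀ x ∈ Icc (0 : ℝ) 1, 0 < z + s * x := fun x hx => by
    have := mul_nonneg hs.le hx.1; linarith
  have h1 : ∫ x in Ioc (0 : ℝ) 1, (1 - x) ^ m * (z / x / (z / x + s)) ^ (m + 2) =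
      ∫ x in (0 : ℝ)..1, (1 - x) ^ m * (z / (z + s * x)) ^ (m + 2) := by
    rw [intervalIntegral.integral_of_le zero_le_one]
    refine setIntegral_congr_fun measurableSet_Ioc fun x hx => ?_
    have hx0 := hx.1
    congr 2
    have := hpos x ⟨hx.1.le, hx.2⟩
    field_simp
  rw [h1, ← intervalIntegral.integral_const_mul]
  rw [intervalIntegral.integral_eq_sub_of_hasDerivAt
    (f := fun x => -(z ^ (m + 2) / (z + s) * ((1 - x) / (z + s * x)) ^ (m + 1)))]
  · simp
    field_simp
    ring
  · intro x hx
    rw [uIcc_of_le zero_le_one] at hx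
    have hp := hpos x hx
    have d1 : HasDerivAt (fun x : ℝ => 1 - x) (-1) x := (hasDerivAt_id x).const_sub 1
    have d2 : HasDerivAt (fun x : ℝ => z + s * x) s x := by
      simpa using ((hasDerivAt_id x).const_mul s).const_add z
    have d3 := ((((d1.div d2 hp.ne').pow (m + 1))).const_mul (z ^ (m + 2) / (z + s))).neg
    convert! d3 using 1
    simp only [Nat.add_sub_cancel, div_pow, Pi.div_apply]
    push_cast
    field_simp
    ring
  · refine ContinuousOn.intervalIntegrable ?_
    rw [uIcc_of_le zero_le_one]
    refine continuousOn_const.mul ((by fun_prop : ContinuousOn _ _).mul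
      ((continuousOn_const.div (by fun_prop) fun x hx => (hpos x hx).ne').pow _))

lemma zfDensity_eq (m : ℕ) (K : ℝ → ℝ → ℝ) (σ δ γ : ℝ) :
    zfDensity (m + 2) K σ δ γ =
      ((m : ℝ) + 1) * (σ / δ * ∫ x in Ioc (0 : ℝ) 1, K 0 (σ / δ * γ * x) * (1 - x) ^ m * x) := by
  rw [zfDensity, intervalIntegral.integral_of_le zero_le_one, mul_assoc]
  congr 1
  · push_cast; ring
  · congr 2
    ext x
    rw [show σ * γ * x / δ = σ / δ * γ * x by ring, Nat.add_sub_cancel]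

lemma integrable_kernel_mul_weight_mul {K : ℝ → ℝ} (hK : IntegrableOn K (Ioi 0)) (m : ℕ)
    {h : ℝ → ℝ} (hh : Measurable h) (hb : ∀ x, 0 < x → |h x| ≤ 1) {c : ℝ} (hc : 0 < c) :
    Integrable (fun z : ℝ × ℝ => K z.2 * (1 - z.1) ^ m * h (z.2 / (c * z.1)))
      ((volume.restrict (Ioc 0 1)).prod (volume.restrict (Ioi 0))) := by
  have hmem : ∀ᵐ z ∂((volume.restrict (Ioc (0 : ℝ) 1)).prod (volume.restrict (Ioi (0 : ℝ)))),
      z.1 ∈ Ioc (0 : ℝ) 1 ∧ z.2 ∈ Ioi (0 : ℝ) := by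
    rw [Measure.prod_restrict]
    exact ae_restrict_mem (measurableSet_Ioc.prod measurableSet_Ioi)
  refine Integrable.mono' (hK.norm.comp_snd (volume.restrict (Ioc 0 1))) ?_ ?_
  · refine (hK.1.comp_snd.mul ?_).mul ?_
    · exact Measurable.aestronglyMeasurable (by fun_prop)
    · exact Measurable.aestronglyMeasurable (by fun_prop)
  · filter_upwards [hmem] with z hz
    rw [norm_mul, norm_mul, mul_assoc]
    refine mul_le_of_le_one_right (norm_nonneg _) (mul_le_one₀ ?_ (norm_nonneg _) ?_)
    · rw [norm_pow, Real.norm_of_nonneg (by linarith [hz.1.2])]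
      exact pow_le_one₀ (by linarith [hz.1.2]) (by linarith [hz.1.1])
    · exact hb _ (div_pos hz.2 (mul_pos hc hz.1.1))

/-- Since log(1 + y/(cx)) = log(x + y/c) - log x, and log t ≤ t - 1 with x ≤ 1, the logarithm is at
most y/c + |log x|. The first term calls for a first moment of K, the second for integrability of
log at 0. -/
lemma integrable_kernel_mul_weight_mul_log {K : ℝ → ℝ} (hK : IntegrableOn K (Ioi 0))
    (hK1 : IntegrableOn (fun y => y * K y) (Ioi 0)) (m : ℕ) {c : ℝ} (hc : 0 < c) :
    Integrable (fun z : ℝ × ℝ => K z.2 * (1 - z.1) ^ m * Real.log (1 + z.2 / (c * z.1)))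
      ((volume.restrict (Ioc 0 1)).prod (volume.restrict (Ioi 0))) := by
  have hmem : ∀ᵐ z ∂((volume.restrict (Ioc (0 : ℝ) 1)).prod (volume.restrict (Ioi (0 : ℝ)))),
      z.1 ∈ Ioc (0 : ℝ) 1 ∧ z.2 ∈ Ioi (0 : ℝ) := by
    rw [Measure.prod_restrict]
    exact ae_restrict_mem (measurableSet_Ioc.prod measurableSet_Ioi)
  have hlog : IntegrableOn Real.log (Ioc 0 1) :=
    (intervalIntegrable_iff_integrableOn_Ioc_of_le zero_le_one).mp
      intervalIntegral.intervalIntegrable_log'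
  have hB := ((hK1.norm.const_mul c⁻¹).comp_snd (volume.restrict (Ioc (0 : ℝ) 1))).add
    (hlog.norm.mul_prod hK.norm)
  refine Integrable.mono' hB ?_ ?_
  · refine (hK.1.comp_snd.mul ?_).mul ?_
    · exact Measurable.aestronglyMeasurable (by fun_prop)
    · exact Measurable.aestronglyMeasurable (by fun_prop)
  · filter_upwards [hmem] with z ⟨⟨hx, hx1⟩, hy⟩
    have hy : 0 < z.2 := hy
    have h1 : ‖(1 - z.1) ^ m‖ ≤ 1 := by
      rw [norm_pow, Real.norm_of_nonneg (by linarith)]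
      exact pow_le_one₀ (by linarith) (by linarith)
    have hq : 0 < z.2 / c := div_pos hy hc
    have h2 : ‖Real.log (1 + z.2 / (c * z.1))‖ ≤ c⁻¹ * z.2 + ‖Real.log z.1‖ := by
      have h3 : 1 + z.2 / (c * z.1) = (z.1 + z.2 / c) / z.1 := by field_simp
      have h4 : 0 ≤ Real.log (1 + z.2 / (c * z.1)) := Real.log_nonneg (by
        have : 0 < z.2 / (c * z.1) := by positivity
        linarith)
      rw [Real.norm_of_nonneg h4, h3, Real.log_div (by positivity) hx.ne']
      have h5 : Real.log (z.1 + z.2 / c) ≤ c⁻¹ * z.2 := by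
        have := Real.log_le_sub_one_of_pos (show 0 < z.1 + z.2 / c by positivity)
        rw [inv_mul_eq_div]
        linarith
      have h6 : -Real.log z.1 ≤ ‖Real.log z.1‖ := neg_le_abs _
      linarith
    rw [norm_mul, norm_mul]
    simp only [Pi.add_apply]
    rw [norm_mul, Real.norm_of_nonneg hy.le]
    calc ‖K z.2‖ * ‖(1 - z.1) ^ m‖ * ‖Real.log (1 + z.2 / (c * z.1))‖
        ≤ ‖K z.2‖ * 1 * (c⁻¹ * z.2 + ‖Real.log z.1‖) := by gcongr
      _ = _ := by ring

lemma integrable_convolution_weight {K : ℝ → ℝ} (hK : IntegrableOn K (Ioi 0)) (m : ℕ) {a : ℝ}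
    (ha : 0 < a) : IntegrableOn (fun x => K (a * x) * (1 - x) ^ m * x) (Ioc 0 1) := by
  have h1 : IntegrableOn (fun x => K (a * x)) (Ioi 0) :=
    (integrableOn_Ioi_comp_mul_left_iff K 0 ha).mpr (by rwa [mul_zero])
  have h2 := h1.mono_set (fun x hx => hx.1 : Ioc (0 : ℝ) 1 ⊆ Ioi 0)
  simp_rw [mul_assoc]
  refine h2.mul_bdd (c := 1) (Measurable.aestronglyMeasurable (by fun_prop)) ?_
  filter_upwards [ae_restrict_mem measurableSet_Ioc] with x hx
  rw [norm_mul, norm_pow, Real.norm_of_nonneg (by linarith [hx.2] : 0 ≤ 1 - x),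
    Real.norm_of_nonneg hx.1.le]
  exact mul_le_one₀ (pow_le_one₀ (by linarith [hx.2]) (by linarith [hx.1])) hx.1.le hx.2

/-- This serves to upgrade almost-everywhere nonnegativity to every γ > 0. K(0,·) need not be
continuous, so the substitution y = cγx moves the parameter into the truncated weight, and dominated
convergence applies. -/
lemma continuousOn_zfDensity (m : ℕ) {K : ℝ → ℝ → ℝ} (hK : IntegrableOn (K 0) (Ioi 0))
    {σ δ : ℝ} (hσ : 0 < σ) (hδ : 0 < δ) :
    ContinuousOn (zfDensity (m + 2) K σ δ) (Ioi 0) := by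
  set c := σ / δ with hc
  have hcp : 0 < c := div_pos hσ hδ
  let Φ : ℝ → ℝ := fun T => ∫ y in Ioi (0 : ℝ), K 0 y * (if y ≤ T then (1 - y / T) ^ m * (y / T) else 0)
  have hΦ : ContinuousOn Φ (Ioi 0) := by
    intro T₀ hT₀
    have hT₀ : 0 < T₀ := hT₀
    refine ContinuousAt.continuousWithinAt ?_
    refine continuousAt_of_dominated (bound := fun y => ‖K 0 y‖) ?_ ?_ hK.norm ?_
    · refine Filter.Eventually.of_forall fun T => hK.1.mul ?_
      exact (Measurable.ite measurableSet_Iic (by fun_prop) (by fun_prop)).aestronglyMeasurable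
    · filter_upwards [Ioi_mem_nhds hT₀] with T hT
      have hT : 0 < T := hT
      filter_upwards [ae_restrict_mem measurableSet_Ioi] with y hy
      have hy : 0 < y := hy
      rw [norm_mul]
      refine mul_le_of_le_one_right (norm_nonneg _) ?_
      split_ifs with h
      · have h1 : y / T ≤ 1 := div_le_one_of_le₀ h hT.le
        have h2 : 0 ≤ y / T := by positivity
        rw [Real.norm_of_nonneg (mul_nonneg (pow_nonneg (by linarith) _) h2)]
        exact mul_le_one₀ (pow_le_one₀ (by linarith) (by linarith)) h2 h1
      · simp
    · have hne : ∀ᵐ y ∂(volume.restrict (Ioi (0 : ℝ))), y ≠ T₀ :=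
        ae_restrict_of_ae (Measure.ae_ne volume T₀)
      filter_upwards [hne] with y hy
      refine continuousAt_const.mul ?_
      rcases lt_or_gt_of_ne hy with h | h
      · refine ContinuousAt.congr (f := fun T => (1 - y / T) ^ m * (y / T)) ?_ ?_
        · have : ContinuousAt (fun T : ℝ => y / T) T₀ :=
            continuousAt_const.div continuousAt_id hT₀.ne'
          exact ((continuousAt_const.sub this).pow m).mul this
        · filter_upwards [Ioi_mem_nhds h] with T hT
          rw [if_pos (le_of_lt hT)]
      · refine ContinuousAt.congr (f := fun _ => 0) continuousAt_const ?_
        filter_upwards [Iio_mem_nhds h] with T hT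
        rw [if_neg (not_le.mpr hT)]
  have heq : ∀ γ ∈ Ioi (0 : ℝ), zfDensity (m + 2) K σ δ γ =
      ((m : ℝ) + 1) * (c * ((c * γ)⁻¹ * Φ (c * γ))) := by
    intro γ hγ
    have hcγ : 0 < c * γ := mul_pos hcp hγ
    rw [zfDensity_eq]
    congr 2
    have h1 := integral_comp_mul_left_Ioi (fun y => K 0 y *
      (if y ≤ c * γ then (1 - y / (c * γ)) ^ m * (y / (c * γ)) else 0)) 0 hcγ
    rw [mul_zero, smul_eq_mul] at h1
    simp only [Φ]
    rw [← h1, ← Ioi_inter_Iic, ← setIntegral_indicator measurableSet_Iic]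
    refine integral_congr_ae (Filter.Eventually.of_forall fun x => ?_)
    simp only [indicator_apply, mem_Iic, mul_le_iff_le_one_right hcγ,
      mul_div_cancel_left₀ _ hcγ.ne']
    split_ifs
    · ring
    · simp
  refine ContinuousOn.congr ?_ heq
  refine continuousOn_const.mul (continuousOn_const.mul (ContinuousOn.mul ?_ ?_))
  · exact ContinuousOn.inv₀ (by fun_prop) fun γ hγ => (mul_pos hcp hγ).ne'
  · exact hΦ.comp (by fun_prop) fun γ hγ => mul_pos hcp hγ

section
variable {m : ℕ} {K : ℝ → ℝ → ℝ} {σ δ : ℝ}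

lemma integrableOn_zfDensity (hK : IntegrableOn (K 0) (Ioi 0)) (hσ : 0 < σ) (hδ : 0 < δ) :
    IntegrableOn (zfDensity (m + 2) K σ δ) (Ioi 0) := by
  have h := (dilation_fubini (K := K 0) (w := fun x => (1 - x) ^ m) (h := fun _ => 1)
    hK.1.aemeasurable (by fun_prop) measurable_const (div_pos hσ hδ)
    (integrable_kernel_mul_weight_mul hK m measurable_const (by simp) (div_pos hσ hδ))).1
  refine ((h.const_mul (σ / δ)).const_mul ((m : ℝ) + 1)).congr
    (Filter.Eventually.of_forall fun γ => ?_)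
  simp only
  rw [zfDensity_eq, mul_one]

lemma integral_zfDensity_mul_resolvent (hK : IntegrableOn (K 0) (Ioi 0)) (hσ : 0 < σ)
    (hδ : 0 < δ) {s : ℝ} (hs : 0 < s) :
    ∫ γ in Ioi (0 : ℝ), zfDensity (m + 2) K σ δ γ * (γ / (γ + s)) ^ (m + 2) =
      ∫ y in Ioi (0 : ℝ), K 0 y * (y / (y + σ / δ * s)) := by
  have hc : 0 < σ / δ := div_pos hσ hδ
  have H := integrable_kernel_mul_weight_mul hK m (h := fun γ => (|γ| / (|γ| + s)) ^ (m + 2))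
    (by fun_prop) (fun x _ => by
      rw [abs_of_nonneg (by positivity)]
      exact pow_le_one₀ (by positivity) (div_le_one_of_le₀ (by linarith) (by positivity))) hc
  have h := (dilation_fubini (K := K 0) (w := fun x => (1 - x) ^ m)
    (h := fun γ => (|γ| / (|γ| + s)) ^ (m + 2))
    hK.1.aemeasurable (by fun_prop) (by fun_prop) hc H).2
  have h1 : ∀ γ ∈ Ioi (0 : ℝ), zfDensity (m + 2) K σ δ γ * (γ / (γ + s)) ^ (m + 2) =
      (((m : ℝ) + 1) * (σ / δ)) * ((∫ x in Ioc (0 : ℝ) 1, K 0 (σ / δ * γ * x) * (1 - x) ^ m * x) *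
        (|γ| / (|γ| + s)) ^ (m + 2)) := by
    intro γ hγ
    rw [zfDensity_eq, abs_of_pos hγ]
    ring
  rw [setIntegral_congr_fun measurableSet_Ioi h1, integral_const_mul, mul_assoc, h,
    ← integral_const_mul]
  refine setIntegral_congr_fun measurableSet_Ioi fun y hy => ?_
  have hy : 0 < y := hy
  have hz : 0 < y / (σ / δ) := div_pos hy hc
  rw [mul_left_comm]
  congr 1
  have h2 := integral_beta_resolvent m hz hs
  rw [show y / (y + σ / δ * s) = y / (σ / δ) / (y / (σ / δ) + s) by field_simp, ← h2]
  congr 1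
  refine setIntegral_congr_fun measurableSet_Ioc fun x hx => ?_
  have : 0 < y / (σ / δ * x) := div_pos hy (mul_pos hc hx.1)
  rw [abs_of_pos this, ← div_div y (σ / δ) x]

lemma zfDensity_mul_log (hK : IntegrableOn (K 0) (Ioi 0))
    (hK1 : IntegrableOn (fun y => y * K 0 y) (Ioi 0)) (hσ : 0 < σ) (hδ : 0 < δ) :
    IntegrableOn (fun γ => zfDensity (m + 2) K σ δ γ * Real.log (1 + γ)) (Ioi 0) ∧
    IntegrableOn (fun y => K 0 y * (((m : ℝ) + 1) *
      ∫ x in Ioc (0 : ℝ) 1, (1 - x) ^ m * Real.log (1 + δ / σ * y / x))) (Ioi 0) ∧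
    ∫ γ in Ioi (0 : ℝ), zfDensity (m + 2) K σ δ γ * Real.log (1 + γ) =
      ∫ y in Ioi (0 : ℝ), K 0 y * (((m : ℝ) + 1) *
        ∫ x in Ioc (0 : ℝ) 1, (1 - x) ^ m * Real.log (1 + δ / σ * y / x)) := by
  have hc : 0 < σ / δ := div_pos hσ hδ
  have H := integrable_kernel_mul_weight_mul_log hK hK1 m hc
  have h := dilation_fubini (K := K 0) (w := fun x => (1 - x) ^ m)
    (h := fun γ => Real.log (1 + γ)) hK.1.aemeasurable (by fun_prop) (by fun_prop) hc H
  have h1 : ∀ γ, zfDensity (m + 2) K σ δ γ * Real.log (1 + γ) =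
      (((m : ℝ) + 1) * (σ / δ)) * ((∫ x in Ioc (0 : ℝ) 1, K 0 (σ / δ * γ * x) * (1 - x) ^ m * x) *
        Real.log (1 + γ)) := by
    intro γ
    rw [zfDensity_eq]
    ring
  have hr : ∀ x y : ℝ, δ / σ * y / x = y / (σ / δ * x) := by
    intro x y
    rw [← div_div, div_div_eq_mul_div]
    ring
  simp_rw [h1, hr]
  refine ⟨h.1.const_mul _, ?_, ?_⟩
  · refine (H.integral_prod_right.const_mul ((m : ℝ) + 1)).congr
      (Filter.Eventually.of_forall fun y => ?_)
    simp only [mul_assoc]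
    rw [integral_const_mul]
    ring
  · rw [integral_const_mul, mul_assoc, h.2, ← integral_const_mul]
    refine integral_congr_ae (Filter.Eventually.of_forall fun y => ?_)
    simp only
    ring

end

/-! ### Mellin–Barnes integrals and the Meijer G-function -/

/-- Write 1/(1+v) = ∫ e^{-t(1+v)} dt and exchange integrals: the v-integral is Γ(s) t^{-s}, the
t-integral then gives Γ(1-s), and the reflection formula concludes. -/
lemma mellin_one_div_one_add {s : ℂ} (h0 : 0 < s.re) (h1 : s.re < 1) :
    MellinConvergent (fun v : ℝ => (1 / (1 + v) : ℂ)) s ∧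
    mellin (fun v : ℝ => (1 / (1 + v) : ℂ)) s = Real.pi / Complex.sin (Real.pi * s) := by
  set l : Measure ℝ := volume.restrict (Ioi 0) with hl
  let f : ℝ × ℝ → ℂ := fun z =>
    Complex.exp (-z.1) * ((z.2 : ℂ) ^ (s - 1) * Complex.exp (-(z.1 * z.2)))
  have hfm : Measurable f := by fun_prop
  have hmem : ∀ᵐ t ∂l, 0 < t := ae_restrict_mem measurableSet_Ioi
  have hnorm : ∀ t : ℝ, ∀ v : ℝ, 0 < v →
      ‖f (t, v)‖ = Real.exp (-t) * (v ^ (s.re - 1) * Real.exp (-(t * v))) := by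
    intro t v hv
    simp only [f, norm_mul, Complex.norm_cpow_eq_rpow_re_of_pos hv, Complex.norm_exp]
    simp
  have hnint : ∀ t : ℝ, 0 < t → ∫ v, ‖f (t, v)‖ ∂l =
      Real.exp (-t) * ((1 / t) ^ s.re * Real.Gamma s.re) := by
    intro t ht
    rw [← Real.integral_rpow_mul_exp_neg_mul_Ioi h0 ht, ← integral_const_mul]
    exact setIntegral_congr_fun measurableSet_Ioi fun v hv => hnorm t v hv
  have hfi : Integrable f (l.prod l) := by
    refine (integrable_prod_iff hfm.aestronglyMeasurable).mpr ⟨?_, ?_⟩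
    · filter_upwards [hmem] with t ht
      have hft : AEStronglyMeasurable (fun v => f (t, v)) l :=
        (hfm.comp measurable_prodMk_left).aestronglyMeasurable
      rw [← integrable_norm_iff hft]
      -- Without integrability the integral would be 0 by convention, against its positive Gamma
      -- value.
      by_contra hni
      have h2 := hnint t ht
      rw [integral_undef hni] at h2
      have h3 : 0 < Real.Gamma s.re := Real.Gamma_pos_of_pos h0
      have : 0 < Real.exp (-t) * ((1 / t) ^ s.re * Real.Gamma s.re) := by positivity
      linarith
    · have hg := (Real.GammaIntegral_convergent (show 0 < 1 - s.re by linarith)).mul_const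
        (Real.Gamma s.re)
      refine hg.congr ?_
      filter_upwards [hmem] with t ht
      rw [hnint t ht, one_div, Real.inv_rpow ht.le, ← Real.rpow_neg ht.le]
      ring_nf
  have hv : ∀ v : ℝ, 0 < v → ∫ t, f (t, v) ∂l = (v : ℂ) ^ (s - 1) • (1 / (1 + v) : ℂ) := by
    intro v hv
    have h2 := Complex.integral_cpow_mul_exp_neg_mul_Ioi (a := 1) (by simp)
      (show 0 < 1 + v by linarith)
    simp only [sub_self, Complex.cpow_zero, one_mul, Complex.cpow_one, Complex.Gamma_one,
      mul_one] at h2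
    rw [smul_eq_mul, ← Complex.ofReal_one, ← Complex.ofReal_add]
    rw [Complex.ofReal_one, ← h2, ← integral_const_mul]
    refine integral_congr_ae (Filter.Eventually.of_forall fun t => ?_)
    simp only [f]
    rw [mul_left_comm, ← Complex.exp_add]
    congr 2
    push_cast
    ring
  have ht : ∀ t : ℝ, 0 < t → ∫ v, f (t, v) ∂l =
      Complex.Gamma s * ((t : ℂ) ^ ((1 - s) - 1) * Complex.exp (-((1 : ℝ) * t))) := by
    intro t ht
    simp only [f]
    rw [integral_const_mul, Complex.integral_cpow_mul_exp_neg_mul_Ioi h0 ht, one_div,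
      Complex.inv_cpow _ _ (by rw [Complex.arg_ofReal_of_nonneg ht.le]; exact Real.pi_pos.ne),
      ← Complex.cpow_neg]
    simp only [Complex.ofReal_one, one_mul]
    ring_nf
  have hconv : MellinConvergent (fun v : ℝ => (1 / (1 + v) : ℂ)) s := by
    refine hfi.integral_prod_right.congr ?_
    filter_upwards [hmem] with v hv'
    exact hv v hv'
  refine ⟨hconv, ?_⟩
  have hsw := integral_integral_swap (f := fun t v => f (t, v)) hfi
  rw [mellin]
  calc ∫ v in Ioi (0 : ℝ), (v : ℂ) ^ (s - 1) • (1 / (1 + v) : ℂ)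
      = ∫ v, ∫ t, f (t, v) ∂l ∂l := by
        refine setIntegral_congr_fun measurableSet_Ioi fun v hv' => (hv v hv').symm
    _ = ∫ t, ∫ v, f (t, v) ∂l ∂l := hsw.symm
    _ = ∫ t in Ioi (0 : ℝ), Complex.Gamma s *
          ((t : ℂ) ^ ((1 - s) - 1) * Complex.exp (-((1 : ℝ) * t))) :=
        setIntegral_congr_fun measurableSet_Ioi fun t ht' => ht t ht'
    _ = _ := by
        rw [integral_const_mul, Complex.integral_cpow_mul_exp_neg_mul_Ioi (by simpa using h1)
          one_pos, ← Complex.Gamma_mul_Gamma_one_sub]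
        simp

/-- The function `π / sin (π s)` along the line `Re s = r`. -/
noncomputable def cosecLine (r t : ℝ) : ℂ :=
  Real.pi / Complex.sin (Real.pi * ((r : ℂ) + (t : ℂ) * Complex.I))

/-- Quadratic growth suffices to make the cosecant integrable along a vertical line; it follows from
cosh 2u = 1 + 2 sinh² u and |sinh u| ≥ |u|. -/
lemma one_add_sq_le_cosh (t : ℝ) : 1 + t ^ 2 ≤ Real.cosh (Real.pi * t) := by
  have h1 : Real.cosh (Real.pi * t) = 1 + 2 * Real.sinh (Real.pi * t / 2) ^ 2 := by
    rw [show Real.pi * t = 2 * (Real.pi * t / 2) by ring, Real.cosh_two_mul, Real.cosh_sq]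
    ring_nf
  have h2 : |Real.pi * t / 2| ≤ |Real.sinh (Real.pi * t / 2)| := by
    rw [Real.abs_sinh]
    exact Real.self_le_sinh_iff.mpr (abs_nonneg _)
  have h3 := sq_le_sq.mpr h2
  have h4 : t ^ 2 ≤ (Real.pi * t / 2) ^ 2 * 2 := by
    have := Real.pi_gt_three
    have h5 : 2 ≤ Real.pi ^ 2 := by nlinarith
    nlinarith [sq_nonneg t]
  rw [h1]; linarith

lemma le_norm_sin_line {r : ℝ} (h0 : 0 < r) (h1 : r < 1) (t : ℝ) :
    Real.sin (Real.pi * r) * (1 + t ^ 2) ≤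
      ‖Complex.sin (Real.pi * ((r : ℂ) + (t : ℂ) * Complex.I))‖ := by
  have hs : 0 < Real.sin (Real.pi * r) :=
    Real.sin_pos_of_pos_of_lt_pi (by positivity) (by nlinarith [Real.pi_pos])
  have h2 : Complex.sin (Real.pi * ((r : ℂ) + (t : ℂ) * Complex.I)) =
      ((Real.sin (Real.pi * r) * Real.cosh (Real.pi * t) : ℝ) : ℂ) +
      ((Real.cos (Real.pi * r) * Real.sinh (Real.pi * t) : ℝ) : ℂ) * Complex.I := by
    rw [show (Real.pi : ℂ) * ((r : ℂ) + (t : ℂ) * Complex.I) =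
      ((Real.pi * r : ℝ) : ℂ) + ((Real.pi * t : ℝ) : ℂ) * Complex.I by push_cast; ring,
      Complex.sin_add_mul_I]
    push_cast
    ring
  have h3 := Complex.abs_re_le_norm (Complex.sin (Real.pi * ((r : ℂ) + (t : ℂ) * Complex.I)))
  refine le_trans ?_ h3
  have h4 : (Complex.sin (Real.pi * ((r : ℂ) + (t : ℂ) * Complex.I))).re =
      Real.sin (Real.pi * r) * Real.cosh (Real.pi * t) := by
    rw [h2, Complex.add_re, Complex.re_ofReal_mul, Complex.ofReal_re, Complex.I_re, mul_zero, add_zero]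
  rw [h4, abs_of_pos (mul_pos hs (Real.cosh_pos _))]
  exact mul_le_mul_of_nonneg_left (one_add_sq_le_cosh t) hs.le

lemma integrable_cosecLine {r : ℝ} (h0 : 0 < r) (h1 : r < 1) : Integrable (cosecLine r) := by
  have hs : 0 < Real.sin (Real.pi * r) :=
    Real.sin_pos_of_pos_of_lt_pi (by positivity) (by nlinarith [Real.pi_pos])
  refine Integrable.mono' (integrable_inv_one_add_sq.const_mul (Real.pi / Real.sin (Real.pi * r)))
    ?_ ?_
  · unfold cosecLine
    exact Measurable.aestronglyMeasurable (by fun_prop)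
  · filter_upwards with t
    have h2 : 0 < 1 + t ^ 2 := by positivity
    rw [cosecLine, norm_div, Complex.norm_real, Real.norm_of_nonneg Real.pi_pos.le,
      ← div_eq_mul_inv, div_div]
    exact div_le_div_of_nonneg_left Real.pi_pos.le (by positivity) (le_norm_sin_line h0 h1 t)

/-- Mellin inversion of 1/(1+v), taken at v⁻¹ so that v^{-s} becomes v^s. -/
lemma div_one_add_eq_integral {r : ℝ} (h0 : 0 < r) (h1 : r < 1) {v : ℝ} (hv : 0 < v) :
    ((v / (1 + v) : ℝ) : ℂ) = (1 / (2 * (Real.pi : ℂ))) *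
      ∫ t : ℝ, cosecLine r t * (v : ℂ) ^ ((r : ℂ) + (t : ℂ) * Complex.I) := by
  have hre : ∀ t : ℝ, ((r : ℂ) + (t : ℂ) * Complex.I).re = r := fun t => by simp
  have hm : ∀ t : ℝ, mellin (fun v : ℝ => (1 / (1 + v) : ℂ)) ((r : ℂ) + (t : ℂ) * Complex.I)
      = cosecLine r t := fun t =>
    (mellin_one_div_one_add (by rw [hre]; exact h0) (by rw [hre]; exact h1)).2
  have hvi : 0 < v⁻¹ := inv_pos.mpr hv
  have hne : (1 : ℂ) + ((v⁻¹ : ℝ) : ℂ) ≠ 0 := by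
    rw [← Complex.ofReal_one, ← Complex.ofReal_add]
    exact Complex.ofReal_ne_zero.mpr (by positivity)
  have key := mellinInv_mellin_eq r (fun v : ℝ => (1 / (1 + v) : ℂ)) hvi
    (mellin_one_div_one_add (s := r) (by simpa using h0) (by simpa using h1)).1
    (by simp only [Complex.VerticalIntegrable, hm]; exact integrable_cosecLine h0 h1)
    (continuousAt_const.div (by fun_prop) hne)
  rw [mellinInv] at key
  simp only [hm] at key
  have h2 : ((v / (1 + v) : ℝ) : ℂ) = 1 / (1 + ((v⁻¹ : ℝ) : ℂ)) := by
    rw [← Complex.ofReal_one, ← Complex.ofReal_add, ← Complex.ofReal_div]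
    congr 1
    field_simp
    ring
  rw [h2, ← key, Complex.real_smul]
  push_cast
  congr 1
  refine integral_congr_ae (Filter.Eventually.of_forall fun t => ?_)
  simp only
  rw [smul_eq_mul, mul_comm, Complex.inv_cpow _ _
    (by rw [Complex.arg_ofReal_of_nonneg hv.le]; exact Real.pi_pos.ne), ← Complex.cpow_neg, neg_neg]

/-- On a vertical line |u^κ| = u^ρ does not depend on t, so a product of integrable functions
dominates. -/
lemma cpow_weight_fubini {φ κ : ℝ → ℂ} {ω : ℝ → ℂ} {ρ : ℝ} (hφ : Integrable φ)
    (hκ : Measurable κ) (hre : ∀ t, (κ t).re = ρ) (hω : Measurable ω)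
    (hi : IntegrableOn (fun u : ℝ => ‖ω u‖ * u ^ ρ) (Ioc 0 1)) :
    Integrable (fun t => φ t * ∫ u in Ioc (0 : ℝ) 1, ω u * (u : ℂ) ^ κ t) ∧
    ∫ u in Ioc (0 : ℝ) 1, ω u * ∫ t, φ t * (u : ℂ) ^ κ t =
      ∫ t, φ t * ∫ u in Ioc (0 : ℝ) 1, ω u * (u : ℂ) ^ κ t := by
  let f : ℝ × ℝ → ℂ := fun z => ω z.1 * (φ z.2 * (z.1 : ℂ) ^ κ z.2)
  have hfi : Integrable f ((volume.restrict (Ioc 0 1)).prod volume) := by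
    refine Integrable.mono' (hi.mul_prod hφ.norm) ?_ ?_
    · refine AEStronglyMeasurable.mul (Measurable.aestronglyMeasurable (by fun_prop))
        (hφ.1.comp_snd.mul (Measurable.aestronglyMeasurable (by fun_prop)))
    · have hmem : ∀ᵐ z ∂((volume.restrict (Ioc (0 : ℝ) 1)).prod (volume : Measure ℝ)),
          z.1 ∈ Ioc (0 : ℝ) 1 :=
        Measure.quasiMeasurePreserving_fst.ae (ae_restrict_mem measurableSet_Ioc)
      filter_upwards [hmem] with z hz
      simp only [f, norm_mul, Complex.norm_cpow_eq_rpow_re_of_pos hz.1, hre]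
      exact le_of_eq (by ring)
  have h1 : ∀ t, ∫ u in Ioc (0 : ℝ) 1, f (u, t) = φ t * ∫ u in Ioc (0 : ℝ) 1, ω u * (u : ℂ) ^ κ t := by
    intro t
    rw [← integral_const_mul]
    refine integral_congr_ae (Filter.Eventually.of_forall fun u => ?_)
    simp only [f]; ring
  refine ⟨hfi.integral_prod_right.congr (Filter.Eventually.of_forall h1), ?_⟩
  have h2 := integral_integral_swap (f := fun u t => f (u, t)) hfi
  simp_rw [h1] at h2
  rw [← h2]
  refine integral_congr_ae (Filter.Eventually.of_forall fun u => ?_)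
  simp only [f]
  rw [integral_const_mul]

lemma log_one_add_eq_integral_Ioc {w : ℝ} (hw : 0 < w) :
    Real.log (1 + w) = ∫ u in Ioc (0 : ℝ) 1, w / (1 + w * u) := by
  rw [← intervalIntegral.integral_of_le zero_le_one]
  have hp : ∀ u ∈ Icc (0 : ℝ) 1, 1 + w * u ≠ 0 := fun u hu => by
    have := mul_nonneg hw.le hu.1; positivity
  rw [intervalIntegral.integral_eq_sub_of_hasDerivAt (f := fun u => Real.log (1 + w * u))]
  · simp
  · intro u hu
    rw [uIcc_of_le zero_le_one] at hu
    have d : HasDerivAt (fun u : ℝ => 1 + w * u) w u := by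
      simpa using ((hasDerivAt_id u).const_mul w).const_add 1
    exact d.log (hp u hu)
  · refine ContinuousOn.intervalIntegrable ?_
    rw [uIcc_of_le zero_le_one]
    exact continuousOn_const.div (by fun_prop) hp

lemma integrableOn_rpow_Ioc {ρ : ℝ} (h : -1 < ρ) : IntegrableOn (fun u : ℝ => u ^ ρ) (Ioc 0 1) :=
  (intervalIntegrable_iff_integrableOn_Ioc_of_le zero_le_one).mp
    (intervalIntegral.intervalIntegrable_rpow' h)

lemma ofReal_mul_cpow_line {x y : ℝ} (hx : 0 ≤ x) (hy : 0 ≤ y) (s : ℂ) :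
    (((x * y : ℝ) : ℂ)) ^ s = (x : ℂ) ^ s * (y : ℂ) ^ s := by
  rw [Complex.ofReal_mul, Complex.mul_cpow_ofReal_nonneg hx hy]

/-- Mellin-Barnes representation of the logarithm. -/
lemma log_one_add_eq_integral {r : ℝ} (h0 : 0 < r) (h1 : r < 1) {w : ℝ} (hw : 0 < w) :
    Integrable (fun t : ℝ => cosecLine r t * (w : ℂ) ^ ((r : ℂ) + (t : ℂ) * Complex.I) /
      ((r : ℂ) + (t : ℂ) * Complex.I)) ∧
    (Real.log (1 + w) : ℂ) = (1 / (2 * (Real.pi : ℂ))) *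
      ∫ t : ℝ, cosecLine r t * (w : ℂ) ^ ((r : ℂ) + (t : ℂ) * Complex.I) /
        ((r : ℂ) + (t : ℂ) * Complex.I) := by
  have hre : ∀ t : ℝ, ((r : ℂ) + (t : ℂ) * Complex.I).re = r := fun t => by simp
  have hφ : Integrable fun t : ℝ => cosecLine r t * (w : ℂ) ^ ((r : ℂ) + (t : ℂ) * Complex.I) := by
    refine (integrable_cosecLine h0 h1).mul_bdd (c := w ^ r)
      (Measurable.aestronglyMeasurable (by fun_prop)) (Filter.Eventually.of_forall fun t => ?_)
    rw [Complex.norm_cpow_eq_rpow_re_of_pos hw, hre]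
  have hi : IntegrableOn (fun u : ℝ => ‖((u : ℂ))⁻¹‖ * u ^ r) (Ioc 0 1) := by
    refine (integrableOn_rpow_Ioc (show -1 < r - 1 by linarith)).congr ?_
    filter_upwards [ae_restrict_mem measurableSet_Ioc] with u hu
    rw [norm_inv, Complex.norm_real, Real.norm_of_nonneg hu.1.le, Real.rpow_sub_one hu.1.ne']
    field_simp
  -- The weight 1/u comes from log(1+w) = ∫ wu/(1+wu) du/u over (0,1]; it contributes the factor
  -- 1/s.
  obtain ⟨hI, hE⟩ := cpow_weight_fubini (ω := fun u => ((u : ℂ))⁻¹)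
    (κ := fun t : ℝ => (r : ℂ) + (t : ℂ) * Complex.I) hφ (by fun_prop) hre (by fun_prop) hi
  have hin : ∀ t : ℝ, ∫ u in Ioc (0 : ℝ) 1, ((u : ℂ))⁻¹ *
      (u : ℂ) ^ ((r : ℂ) + (t : ℂ) * Complex.I) = 1 / ((r : ℂ) + (t : ℂ) * Complex.I) := by
    intro t
    have hb := Complex.betaIntegral_eval_one_right (u := (r : ℂ) + (t : ℂ) * Complex.I)
      (by rw [hre]; exact h0)
    rw [← hb, Complex.betaIntegral, intervalIntegral.integral_of_le zero_le_one]
    refine setIntegral_congr_fun measurableSet_Ioc fun u hu => ?_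
    have : (u : ℂ) ≠ 0 := Complex.ofReal_ne_zero.mpr hu.1.ne'
    simp only [sub_self, Complex.cpow_zero, mul_one]
    rw [Complex.cpow_sub _ _ this, Complex.cpow_one]
    field_simp
  simp_rw [hin, mul_one_div] at hI hE
  refine ⟨hI, ?_⟩
  rw [← hE, log_one_add_eq_integral_Ioc hw, ← integral_complex_ofReal, ← integral_const_mul]
  refine setIntegral_congr_fun measurableSet_Ioc fun u hu => ?_
  have hu0 : (u : ℂ) ≠ 0 := Complex.ofReal_ne_zero.mpr hu.1.ne'
  have h2 := div_one_add_eq_integral h0 h1 (mul_pos hw hu.1)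
  simp_rw [ofReal_mul_cpow_line hw.le hu.1.le, ← mul_assoc] at h2
  rw [mul_left_comm, ← h2, ← Complex.ofReal_inv, ← Complex.ofReal_mul]
  congr 1
  have := hu.1.ne'
  field_simp

/-- The Meijer G-function as the beta average of a logarithm. -/
lemma meijerG_eq (m : ℕ) {r : ℝ} (h0 : 0 < r) (h1 : r < 1) {z : ℝ} (hz : 0 < z) :
    Integrable (fun t : ℝ => meijerIntegrand [1, 1] [((m + 2 : ℕ) : ℂ)] [1, 1] [0] (z : ℂ)
      ((r : ℂ) + (t : ℂ) * Complex.I)) ∧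
    (((m + 1).factorial : ℂ)) * meijerG r [1, 1] [((m + 2 : ℕ) : ℂ)] [1, 1] [0] (z : ℂ) =
      ((((m : ℝ) + 1) * ∫ x in Ioc (0 : ℝ) 1, (1 - x) ^ m * Real.log (1 + z / x) : ℝ) : ℂ) := by
  have hre : ∀ t : ℝ, ((r : ℂ) + (t : ℂ) * Complex.I).re = r := fun t => by simp
  have hi : IntegrableOn (fun u : ℝ => ‖(((1 - u) ^ m : ℝ) : ℂ)‖ * u ^ (-r)) (Ioc 0 1) := by
    refine (integrableOn_rpow_Ioc (show -1 < -r by linarith)).bdd_mul (c := 1)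
      (Measurable.aestronglyMeasurable (by fun_prop)) ?_
    filter_upwards [ae_restrict_mem measurableSet_Ioc] with u hu
    rw [norm_norm, Complex.norm_real, norm_pow, Real.norm_of_nonneg (by linarith [hu.2])]
    exact pow_le_one₀ (by linarith [hu.2]) (by linarith [hu.1])
  obtain ⟨hI, hE⟩ := cpow_weight_fubini (ω := fun u => (((1 - u) ^ m : ℝ) : ℂ))
    (κ := fun t : ℝ => -((r : ℂ) + (t : ℂ) * Complex.I)) (ρ := -r)
    (log_one_add_eq_integral h0 h1 hz).1
    (by fun_prop) (fun t => by simp) (by fun_prop) hi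
  -- The beta integral B(1-s, m+1).
  have hin : ∀ t : ℝ, ∫ u in Ioc (0 : ℝ) 1, (((1 - u) ^ m : ℝ) : ℂ) *
      (u : ℂ) ^ (-((r : ℂ) + (t : ℂ) * Complex.I)) =
      Complex.Gamma (1 - ((r : ℂ) + (t : ℂ) * Complex.I)) * m.factorial /
        Complex.Gamma (((m + 2 : ℕ) : ℂ) - ((r : ℂ) + (t : ℂ) * Complex.I)) := by
    intro t
    have hb := Complex.betaIntegral_eq_Gamma_mul_div (1 - ((r : ℂ) + (t : ℂ) * Complex.I))
      ((m : ℂ) + 1) (by rw [Complex.sub_re, hre]; simpa using h1) (by simp; positivity)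
    rw [Complex.Gamma_nat_eq_factorial] at hb
    rw [show ((m + 2 : ℕ) : ℂ) - ((r : ℂ) + (t : ℂ) * Complex.I) =
      1 - ((r : ℂ) + (t : ℂ) * Complex.I) + ((m : ℂ) + 1) by push_cast; ring, ← hb,
      Complex.betaIntegral, intervalIntegral.integral_of_le zero_le_one]
    refine setIntegral_congr_fun measurableSet_Ioc fun u hu => ?_
    simp only [add_sub_cancel_right, Complex.cpow_natCast]
    rw [show (1 : ℂ) - ((r : ℂ) + (t : ℂ) * Complex.I) - 1 = -((r : ℂ) + (t : ℂ) * Complex.I) by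
      ring]
    push_cast
    ring
  simp_rw [hin] at hI hE
  -- The integrands match because π/sin(πs) = Γ(s)Γ(1-s) and 1/s = Γ(s)/Γ(1+s).
  have hM : ∀ t : ℝ, cosecLine r t * (z : ℂ) ^ ((r : ℂ) + (t : ℂ) * Complex.I) /
        ((r : ℂ) + (t : ℂ) * Complex.I) *
      (Complex.Gamma (1 - ((r : ℂ) + (t : ℂ) * Complex.I)) * m.factorial /
        Complex.Gamma (((m + 2 : ℕ) : ℂ) - ((r : ℂ) + (t : ℂ) * Complex.I))) =
      m.factorial * meijerIntegrand [1, 1] [((m + 2 : ℕ) : ℂ)] [1, 1] [0] (z : ℂ)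
        ((r : ℂ) + (t : ℂ) * Complex.I) := by
    intro t
    have hc : cosecLine r t = Complex.Gamma ((r : ℂ) + (t : ℂ) * Complex.I) *
        Complex.Gamma (1 - ((r : ℂ) + (t : ℂ) * Complex.I)) :=
      (Complex.Gamma_mul_Gamma_one_sub _).symm
    have hs0 : (r : ℂ) + (t : ℂ) * Complex.I ≠ 0 := fun h => by
      have := congrArg Complex.re h
      rw [hre] at this
      exact h0.ne' this
    have hG0 := Complex.Gamma_ne_zero_of_re_pos (s := (r : ℂ) + (t : ℂ) * Complex.I)
      (by rw [hre]; exact h0)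
    have hG1 := Complex.Gamma_add_one _ hs0
    rw [hc]
    generalize (r : ℂ) + (t : ℂ) * Complex.I = s at *
    simp only [meijerIntegrand, List.map_cons, List.map_nil, List.prod_cons, List.prod_nil,
      mul_one, sub_self, zero_add, sub_zero]
    rw [add_comm 1 s, hG1]
    generalize Complex.Gamma (((m + 2 : ℕ) : ℂ) - s) = G
    by_cases hG : G = 0
    · simp [hG]
    · field_simp
  simp_rw [hM] at hI hE
  have hm0 : (m.factorial : ℂ) ≠ 0 := Nat.cast_ne_zero.mpr m.factorial_ne_zero
  refine ⟨?_, ?_⟩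
  · have := hI.const_mul ((m.factorial : ℂ)⁻¹)
    simpa only [inv_mul_cancel_left₀ hm0] using this
  · rw [integral_const_mul] at hE
    rw [meijerG, Nat.factorial_succ, Complex.ofReal_mul, ← integral_complex_ofReal]
    have h2 : ∫ x in Ioc (0 : ℝ) 1, (((1 - x) ^ m * Real.log (1 + z / x) : ℝ) : ℂ) =
        (1 / (2 * (Real.pi : ℂ))) * ∫ u in Ioc (0 : ℝ) 1, (((1 - u) ^ m : ℝ) : ℂ) *
        ∫ t : ℝ, cosecLine r t * (z : ℂ) ^ ((r : ℂ) + (t : ℂ) * Complex.I) /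
          ((r : ℂ) + (t : ℂ) * Complex.I) * (u : ℂ) ^ (-((r : ℂ) + (t : ℂ) * Complex.I)) := by
      rw [← integral_const_mul]
      refine setIntegral_congr_fun measurableSet_Ioc fun u hu => ?_
      rw [Complex.ofReal_mul, (log_one_add_eq_integral h0 h1 (div_pos hz hu.1)).2, mul_left_comm]
      congr 2
      refine integral_congr_ae (Filter.Eventually.of_forall fun t => ?_)
      simp only
      rw [div_eq_mul_inv z, ofReal_mul_cpow_line hz.le (inv_nonneg.mpr hu.1.le),
        Complex.ofReal_inv, Complex.inv_cpow _ _
        (by rw [Complex.arg_ofReal_of_nonneg hu.1.le]; exact Real.pi_pos.ne), ← Complex.cpow_neg]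
      ring
    rw [h2, hE]
    push_cast
    ring

/-! ### Reduction of the SINR to a quadratic form -/

lemma measurable_conjugateDiagonal (n : ℕ) : Measurable (conjugateDiagonal (n := n)) := by
  refine Continuous.measurable ?_
  unfold conjugateDiagonal
  have h1 : Continuous fun x : Matrix.unitaryGroup (Fin n) ℂ × (Fin n → ℝ) =>
      (x.1 : Matrix (Fin n) (Fin n) ℂ) := continuous_subtype_val.comp continuous_fst
  have h2 : Continuous fun x : Matrix.unitaryGroup (Fin n) ℂ × (Fin n → ℝ) =>
      Matrix.diagonal (fun i => ((x.2 i : ℝ) : ℂ)) := Continuous.matrix_diagonal (by fun_prop)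
  exact (h1.matrix_conjTranspose.matrix_mul h2).matrix_mul h1

/-- Inversion is not continuous at singular matrices, but it is the adjugate times the reciprocal of
the determinant, and both factors are measurable. -/
lemma measurable_matrix_inv (n : ℕ) :
    Measurable fun A : Matrix (Fin n) (Fin n) ℂ => A⁻¹ := by
  have h1 : Measurable fun A : Matrix (Fin n) (Fin n) ℂ => A.det⁻¹ :=
    (continuous_id.matrix_det).measurable.inv
  have h2 : Measurable fun A : Matrix (Fin n) (Fin n) ℂ => A.adjugate :=
    (continuous_id.matrix_adjugate).measurable
  simp_rw [Matrix.inv_def, Ring.inverse_eq_inv']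
  refine measurable_pi_iff.mpr fun i => measurable_pi_iff.mpr fun j => ?_
  exact h1.mul ((measurable_pi_apply j).comp ((measurable_pi_apply i).comp h2))

/-- The zero-forcing SINR as a function of the Gram matrix of the uncorrelated channel. -/
noncomputable def gramSINR {n : ℕ} (δ : ℝ) (S : Matrix (Fin n) (Fin n) ℂ) (k : Fin n)
    (A : Matrix (Fin n) (Fin n) ℂ) : ℝ :=
  δ / (((S * A * S)⁻¹) k k).re

lemma measurable_gramSINR {n : ℕ} (δ : ℝ) (S : Matrix (Fin n) (Fin n) ℂ) (k : Fin n) :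
    Measurable (gramSINR δ S k) := by
  have h1 : Measurable fun A : Matrix (Fin n) (Fin n) ℂ => S * A * S :=
    Continuous.measurable (by fun_prop)
  have h2 := (measurable_matrix_inv n).comp h1
  refine measurable_const.div (Complex.measurable_re.comp ?_)
  exact (measurable_pi_apply k).comp ((measurable_pi_apply k).comp h2)

section sqrt
variable {n : ℕ} {Sig : Matrix (Fin n) (Fin n) ℂ}

lemma sqrt_mul_sqrt_of_posDef (h : Sig.PosDef) : CFC.sqrt Sig * CFC.sqrt Sig = Sig :=
  CFC.sqrt_mul_sqrt_self Sig (Matrix.nonneg_iff_posSemidef.mpr h.posSemidef)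

lemma isHermitian_sqrt : (CFC.sqrt Sig)ᴴ = CFC.sqrt Sig :=
  (Matrix.nonneg_iff_posSemidef.mp (CFC.sqrt_nonneg Sig)).isHermitian

lemma isUnit_det_sqrt (h : Sig.PosDef) : IsUnit (CFC.sqrt Sig).det := by
  rw [isUnit_iff_ne_zero]
  intro h0
  have h1 := congrArg Matrix.det (sqrt_mul_sqrt_of_posDef h)
  rw [Matrix.det_mul, h0, mul_zero] at h1
  exact h.det_pos.ne' h1.symm

lemma zfSINR_eq_gramSINR {l : ℕ} (δ : ℝ) (P : Matrix (Fin l) (Fin n) ℂ) (k : Fin n) :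
    zfSINR δ (P * CFC.sqrt Sig) k = gramSINR δ (CFC.sqrt Sig) k (Pᴴ * P) := by
  rw [zfSINR, gramSINR, Matrix.conjTranspose_mul, isHermitian_sqrt]
  simp only [mul_assoc, Matrix.mul_assoc]

/-- This holds by Σ⁻¹ = (Σ^{-1/2})† Σ^{-1/2}, and it is the way in which σ_k enters the law. -/
lemma sumNormSq_col_inv_sqrt (h : Sig.PosDef) (k : Fin n) :
    sumNormSq (fun j => (CFC.sqrt Sig)⁻¹ j k) = invDiag Sig k := by
  have h1 : Sig⁻¹ = ((CFC.sqrt Sig)⁻¹)ᴴ * (CFC.sqrt Sig)⁻¹ := by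
    rw [Matrix.conjTranspose_nonsing_inv, isHermitian_sqrt, ← Matrix.mul_inv_rev,
      sqrt_mul_sqrt_of_posDef h]
  rw [invDiag, h1, Matrix.mul_apply]
  have h2 := sumNormSq_eq (fun j => (CFC.sqrt Sig)⁻¹ j k)
  have h3 := congrArg Complex.re h2
  rw [Complex.ofReal_re] at h3
  rw [h3]
  rfl

lemma col_inv_sqrt_ne_zero (h : Sig.PosDef) (k : Fin n) :
    (fun j => (CFC.sqrt Sig)⁻¹ j k) ≠ 0 := by
  intro h0
  have h1 := Matrix.mul_nonsing_inv _ (isUnit_det_sqrt h)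
  have h2 := congrFun (congrFun h1 k) k
  rw [Matrix.mul_apply, Matrix.one_apply_eq] at h2
  have h3 : ∀ j, (CFC.sqrt Sig)⁻¹ j k = 0 := fun j => congrFun h0 j
  simp [h3] at h2

lemma invDiag_pos (h : Sig.PosDef) (k : Fin n) : 0 < invDiag Sig k := by
  rw [← sumNormSq_col_inv_sqrt h]
  exact sumNormSq_pos (col_inv_sqrt_ne_zero h k)

/-- With B = UΣ^{-1/2} the inverse Gram matrix is B† diag(1/λ) B. -/
lemma gramSINR_conjugateDiagonal (h : Sig.PosDef) (δ : ℝ) (k : Fin n)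
    (U : Matrix.unitaryGroup (Fin n) ℂ) {lam : Fin n → ℝ} (hl : ∀ i, 0 < lam i) :
    gramSINR δ (CFC.sqrt Sig) k (conjugateDiagonal (U, lam)) =
      δ / ∑ i, (lam i)⁻¹ *
        ‖((U : Matrix (Fin n) (Fin n) ℂ) *ᵥ fun j => (CFC.sqrt Sig)⁻¹ j k) i‖ ^ 2 := by
  set S := CFC.sqrt Sig with hS
  have hSu := isUnit_det_sqrt h
  have hU : (U : Matrix (Fin n) (Fin n) ℂ)ᴴ * U = 1 := Matrix.mem_unitaryGroup_iff'.mp U.2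
  have hU' : (U : Matrix (Fin n) (Fin n) ℂ) * (U : Matrix (Fin n) (Fin n) ℂ)ᴴ = 1 :=
    Matrix.mem_unitaryGroup_iff.mp U.2
  set D : Matrix (Fin n) (Fin n) ℂ := Matrix.diagonal fun i => ((lam i : ℝ) : ℂ) with hD
  set E : Matrix (Fin n) (Fin n) ℂ := Matrix.diagonal fun i => (((lam i)⁻¹ : ℝ) : ℂ) with hE
  have hDE : D * E = 1 := by
    rw [hD, hE, Matrix.diagonal_mul_diagonal, ← Matrix.diagonal_one]
    congr 1
    ext i
    rw [← Complex.ofReal_mul, mul_inv_cancel₀ (hl i).ne', Complex.ofReal_one]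
  set B : Matrix (Fin n) (Fin n) ℂ := (U : Matrix (Fin n) (Fin n) ℂ) * S⁻¹ with hB
  have hBH : Bᴴ = S⁻¹ * (U : Matrix (Fin n) (Fin n) ℂ)ᴴ := by
    rw [hB, Matrix.conjTranspose_mul, Matrix.conjTranspose_nonsing_inv, hS, isHermitian_sqrt]
  have hinv : (S * conjugateDiagonal (U, lam) * S)⁻¹ = Bᴴ * E * B := by
    refine Matrix.inv_eq_right_inv ?_
    rw [hBH, hB, conjugateDiagonal]
    calc S * ((U : Matrix (Fin n) (Fin n) ℂ)ᴴ * D * U) * S *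
          (S⁻¹ * (U : Matrix (Fin n) (Fin n) ℂ)ᴴ * E * (U * S⁻¹))
        = S * (U : Matrix (Fin n) (Fin n) ℂ)ᴴ * D * U * (S * S⁻¹) *
          (U : Matrix (Fin n) (Fin n) ℂ)ᴴ * E * U * S⁻¹ := by simp only [Matrix.mul_assoc]
      _ = S * (U : Matrix (Fin n) (Fin n) ℂ)ᴴ * D * (U * (U : Matrix (Fin n) (Fin n) ℂ)ᴴ) *
          E * U * S⁻¹ := by
          rw [Matrix.mul_nonsing_inv _ hSu, Matrix.mul_one]; simp only [Matrix.mul_assoc]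
      _ = S * (U : Matrix (Fin n) (Fin n) ℂ)ᴴ * (D * E) * U * S⁻¹ := by
          rw [hU', Matrix.mul_one]; simp only [Matrix.mul_assoc]
      _ = S * ((U : Matrix (Fin n) (Fin n) ℂ)ᴴ * U) * S⁻¹ := by
          rw [hDE, Matrix.mul_one]; simp only [Matrix.mul_assoc]
      _ = 1 := by rw [hU, Matrix.mul_one, Matrix.mul_nonsing_inv _ hSu]
  rw [gramSINR, hinv]
  congr 1
  have hcol : ∀ i, B i k = ((U : Matrix (Fin n) (Fin n) ℂ) *ᵥ fun j => S⁻¹ j k) i := fun i => rfl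
  have hsum : (Bᴴ * E * B) k k = ((∑ i, (lam i)⁻¹ * ‖B i k‖ ^ 2 : ℝ) : ℂ) := by
    rw [Matrix.mul_apply, Complex.ofReal_sum]
    refine Finset.sum_congr rfl fun i _ => ?_
    rw [hE, Matrix.mul_diagonal, Matrix.conjTranspose_apply, Complex.ofReal_mul,
      Complex.ofReal_pow, ← Complex.conj_mul', Complex.star_def]
    ring
  rw [hsum, Complex.ofReal_re]
  simp only [hcol]

end sqrt

/-! ### The law of the SINR and its logarithmic moment -/

section ensemble
variable {Ω : Type*} [MeasurableSpace Ω] {μ : Measure Ω} {l n : ℕ}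
  {P : Ω → Matrix (Fin l) (Fin n) ℂ} {p : Fin n → Polynomial ℝ} {q : Fin n → ℝ → ℝ}

lemma IsInvariantPolynomialEnsemble.integrableOn_pow_mul
    (hP : IsInvariantPolynomialEnsemble μ P p q) {a : ℕ} (ha : a < n) (b : Fin n) :
    IntegrableOn (fun x => x ^ a * q b x) (Ioi 0) :=
  integrableOn_pow_mul_of_monic hP.monic hP.natDegree_eq (fun a => hP.integrable a b) a ha

lemma IsInvariantPolynomialEnsemble.integrableOn_pow_mul_kernel
    (hP : IsInvariantPolynomialEnsemble μ P p q) {a : ℕ} (ha : a < n) :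
    IntegrableOn (fun x => x ^ a * polyKernel p q 0 x) (Ioi 0) := by
  have : ∀ x, x ^ a * polyKernel p q 0 x = ∑ j, (p j).eval 0 * (x ^ a * q j x) := fun x => by
    rw [polyKernel, Finset.mul_sum]
    exact Finset.sum_congr rfl fun j _ => by ring
  simp_rw [this]
  exact integrable_finsetSum _ fun j _ => (hP.integrableOn_pow_mul ha j).const_mul _

/-- Measurability of q_b is not a hypothesis; it is contained in the integrability of x^0 q_b. -/
lemma IsInvariantPolynomialEnsemble.aemeasurable_eigenvalueDensity
    (hP : IsInvariantPolynomialEnsemble μ P p q) :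
    AEMeasurable (eigenvalueDensity q) (volume.restrict (positiveOrthant n)) := by
  rw [measure_restrict_positiveOrthant]
  have hq : ∀ a b : Fin n, AEMeasurable (fun lam : Fin n → ℝ => q b (lam a))
      (Measure.pi fun _ : Fin n => (volume : Measure ℝ).restrict (Ioi 0)) := by
    intro a b
    have h := (hP.integrableOn_pow_mul (Fin.pos a) b).1.aemeasurable
    simp only [pow_zero, one_mul] at h
    exact h.comp_quasiMeasurePreserving (Measure.quasiMeasurePreserving_eval _ a)
  unfold eigenvalueDensity
  refine AEMeasurable.mul (Measurable.aemeasurable (by fun_prop)) ?_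
  simp_rw [Matrix.det_apply']
  refine Finset.aemeasurable_fun_sum _ fun σ _ => ?_
  exact (Finset.aemeasurable_fun_prod _ fun i _ => hq _ _).const_mul _

lemma ae_eigenvalueLaw_pos (q : Fin n → ℝ → ℝ) : ∀ᵐ lam ∂(eigenvalueLaw q), ∀ i, 0 < lam i := by
  have hms : MeasurableSet (positiveOrthant n) := by
    have : positiveOrthant n = Set.pi Set.univ fun _ => Ioi (0 : ℝ) := by
      ext; simp [positiveOrthant]
    rw [this]
    exact MeasurableSet.univ_pi fun _ => measurableSet_Ioi
  exact (withDensity_absolutelyContinuous _ _).ae_le (ae_restrict_mem hms)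

instance sFinite_eigenvalueLaw (q : Fin n → ℝ → ℝ) : SFinite (eigenvalueLaw q) := by
  unfold eigenvalueLaw; infer_instance

lemma IsInvariantPolynomialEnsemble.aemeasurable_gram
    (hP : IsInvariantPolynomialEnsemble μ P p q) :
    AEMeasurable (fun ω => (P ω)ᴴ * P ω) μ := by
  have h : Measurable fun A : Matrix (Fin l) (Fin n) ℂ => Aᴴ * A :=
    Continuous.measurable (continuous_id.matrix_conjTranspose.matrix_mul continuous_id)
  exact h.comp_aemeasurable hP.aemeasurable

/-- The normalisation is read off by comparing total masses in `law`. -/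
lemma IsInvariantPolynomialEnsemble.isProbabilityMeasure_eigenvalueLaw [IsProbabilityMeasure μ]
    (hP : IsInvariantPolynomialEnsemble μ P p q) : IsProbabilityMeasure (eigenvalueLaw q) := by
  have h1 : (μ.map fun ω => (P ω)ᴴ * P ω) univ = 1 := by
    rw [Measure.map_apply_of_aemeasurable hP.aemeasurable_gram MeasurableSet.univ]
    simp
  rw [hP.law, Measure.map_apply (measurable_conjugateDiagonal n) MeasurableSet.univ,
    preimage_univ, ← univ_prod_univ, Measure.prod_prod, measure_univ, one_mul] at h1
  exact ⟨h1⟩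

variable {Sig : Matrix (Fin n) (Fin n) ℂ} {δ : ℝ}

lemma IsInvariantPolynomialEnsemble.aemeasurable_zfSINR
    (hP : IsInvariantPolynomialEnsemble μ P p q) (k : Fin n) :
    AEMeasurable (fun ω => zfSINR δ (P ω * CFC.sqrt Sig) k) μ := by
  simp_rw [zfSINR_eq_gramSINR]
  exact (measurable_gramSINR δ _ k).comp_aemeasurable hP.aemeasurable_gram

lemma IsInvariantPolynomialEnsemble.map_zfSINR
    (hP : IsInvariantPolynomialEnsemble μ P p q) (k : Fin n) :
    μ.map (fun ω => zfSINR δ (P ω * CFC.sqrt Sig) k) =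
      ((haarUnitary n).prod (eigenvalueLaw q)).map
        fun z => gramSINR δ (CFC.sqrt Sig) k (conjugateDiagonal z) := by
  simp_rw [zfSINR_eq_gramSINR]
  have h1 := AEMeasurable.map_map_of_aemeasurable (μ := μ)
    (measurable_gramSINR δ (CFC.sqrt Sig) k).aemeasurable hP.aemeasurable_gram
  rw [hP.law, Measure.map_map (measurable_gramSINR δ _ k) (measurable_conjugateDiagonal n)] at h1
  exact h1.symm

lemma quadraticForm_pos {v : Fin n → ℂ} (hv : v ≠ 0) (U : Matrix.unitaryGroup (Fin n) ℂ)
    {lam : Fin n → ℝ} (hl : ∀ i, 0 < lam i) :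
    0 < ∑ i, (lam i)⁻¹ * ‖((U : Matrix (Fin n) (Fin n) ℂ) *ᵥ v) i‖ ^ 2 := by
  have h1 : (U : Matrix (Fin n) (Fin n) ℂ) *ᵥ v ≠ 0 := by
    intro h0
    have h2 := sumNormSq_unitary U v
    rw [h0] at h2
    have h3 := sumNormSq_pos hv
    rw [← h2] at h3
    simp [sumNormSq] at h3
  obtain ⟨i, hi⟩ := Function.ne_iff.mp h1
  have hni := norm_pos_iff.mpr hi
  have hli := hl i
  refine Finset.sum_pos' (fun j _ => ?_) ⟨i, Finset.mem_univ i, by positivity⟩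
  have := hl j
  positivity

lemma ae_prod_eigenvalueLaw_pos (q : Fin n → ℝ → ℝ) :
    ∀ᵐ z ∂((haarUnitary n).prod (eigenvalueLaw q)), ∀ i, 0 < z.2 i :=
  Measure.quasiMeasurePreserving_snd.ae (ae_eigenvalueLaw_pos q)

lemma IsInvariantPolynomialEnsemble.map_zfSINR_Iic
    (hP : IsInvariantPolynomialEnsemble μ P p q) (hS : Sig.PosDef) (hδ : 0 < δ) (k : Fin n) :
    μ.map (fun ω => zfSINR δ (P ω * CFC.sqrt Sig) k) (Iic 0) = 0 := by
  have hgm : Measurable fun z => gramSINR δ (CFC.sqrt Sig) k (conjugateDiagonal (n := n) z) :=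
    (measurable_gramSINR δ _ k).comp (measurable_conjugateDiagonal n)
  rw [hP.map_zfSINR, Measure.map_apply hgm measurableSet_Iic]
  refine measure_mono_null (t := {z | ¬ ∀ i, 0 < z.2 i}) ?_ (ae_prod_eigenvalueLaw_pos q)
  intro z hz hl
  have h1 : gramSINR δ (CFC.sqrt Sig) k (conjugateDiagonal (z.1, z.2)) ≤ 0 := hz
  rw [gramSINR_conjugateDiagonal hS δ k z.1 hl] at h1
  exact absurd (div_pos hδ (quadraticForm_pos (col_inv_sqrt_ne_zero hS k) z.1 hl)) h1.not_gt

lemma IsInvariantPolynomialEnsemble.integral_resolvent_zfSINR [IsProbabilityMeasure μ]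
    (hP : IsInvariantPolynomialEnsemble μ P p q) (hS : Sig.PosDef) (hδ : 0 < δ) (k : Fin n)
    {s : ℝ} (hs : 0 < s) :
    ∫ x, (x / (x + s)) ^ n ∂(μ.map fun ω => zfSINR δ (P ω * CFC.sqrt Sig) k) =
      ∫ y in Ioi (0 : ℝ), polyKernel p q 0 y * (y / (y + invDiag Sig k / δ * s)) := by
  have hn : n ≠ 0 := fun h => (h ▸ k).elim0
  have hprob := hP.isProbabilityMeasure_eigenvalueLaw
  have hσ := invDiag_pos hS k
  set c := invDiag Sig k / δ with hc
  have hcs : 0 ≤ c * s := by positivity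
  have hgm : Measurable fun z => gramSINR δ (CFC.sqrt Sig) k (conjugateDiagonal (n := n) z) :=
    (measurable_gramSINR δ _ k).comp (measurable_conjugateDiagonal n)
  have hfm : Measurable fun x : ℝ => (x / (x + s)) ^ n := by fun_prop
  rw [hP.map_zfSINR, integral_map hgm.aemeasurable hfm.aestronglyMeasurable]
  -- This is the integrand of the unitary average with a_i = s/(δλ_i).
  have hval : ∀ (U : Matrix.unitaryGroup (Fin n) ℂ) (lam : Fin n → ℝ), (∀ i, 0 < lam i) →
      (gramSINR δ (CFC.sqrt Sig) k (conjugateDiagonal (U, lam)) /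
        (gramSINR δ (CFC.sqrt Sig) k (conjugateDiagonal (U, lam)) + s)) ^ n =
      (1 / (1 + ∑ i, s / (δ * lam i) * ‖((U : Matrix (Fin n) (Fin n) ℂ) *ᵥ
        fun j => (CFC.sqrt Sig)⁻¹ j k) i‖ ^ 2)) ^ n := by
    intro U lam hl
    rw [gramSINR_conjugateDiagonal hS δ k U hl]
    have hY := quadraticForm_pos (col_inv_sqrt_ne_zero hS k) U hl
    have h1 : ∑ i, s / (δ * lam i) * ‖((U : Matrix (Fin n) (Fin n) ℂ) *ᵥ
        fun j => (CFC.sqrt Sig)⁻¹ j k) i‖ ^ 2 = s / δ * ∑ i, (lam i)⁻¹ *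
        ‖((U : Matrix (Fin n) (Fin n) ℂ) *ᵥ fun j => (CFC.sqrt Sig)⁻¹ j k) i‖ ^ 2 := by
      rw [Finset.mul_sum]
      refine Finset.sum_congr rfl fun i _ => ?_
      rw [← mul_assoc, ← div_eq_mul_inv, div_div]
    rw [h1]
    generalize ∑ i, (lam i)⁻¹ * ‖((U : Matrix (Fin n) (Fin n) ℂ) *ᵥ
      fun j => (CFC.sqrt Sig)⁻¹ j k) i‖ ^ 2 = Y at hY
    congr 1
    field_simp
  have hbd : Integrable (fun z : Matrix.unitaryGroup (Fin n) ℂ × (Fin n → ℝ) =>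
      (gramSINR δ (CFC.sqrt Sig) k (conjugateDiagonal z) /
        (gramSINR δ (CFC.sqrt Sig) k (conjugateDiagonal z) + s)) ^ n)
      ((haarUnitary n).prod (eigenvalueLaw q)) := by
    refine Integrable.of_bound (hfm.comp hgm).aestronglyMeasurable 1 ?_
    filter_upwards [ae_prod_eigenvalueLaw_pos q] with z hz
    have h1 := gramSINR_conjugateDiagonal hS δ k z.1 hz
    have h2 := div_pos hδ (quadraticForm_pos (col_inv_sqrt_ne_zero hS k) z.1 hz)
    rw [← h1] at h2
    have h3 : 0 < gramSINR δ (CFC.sqrt Sig) k (conjugateDiagonal z) := h2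
    rw [Real.norm_of_nonneg (by positivity)]
    exact pow_le_one₀ (by positivity) (div_le_one_of_le₀ (by linarith) (by linarith))
  rw [integral_prod_symm _ hbd]
  have hin : ∀ lam : Fin n → ℝ, (∀ i, 0 < lam i) →
      ∫ U, (gramSINR δ (CFC.sqrt Sig) k (conjugateDiagonal (U, lam)) /
        (gramSINR δ (CFC.sqrt Sig) k (conjugateDiagonal (U, lam)) + s)) ^ n ∂(haarUnitary n) =
      ∏ i, lam i / (lam i + c * s) := by
    intro lam hl
    simp_rw [hval _ lam hl]
    rw [integral_haarUnitary_resolvent (col_inv_sqrt_ne_zero hS k)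
      fun i => (div_pos hs (mul_pos hδ (hl i))).le]
    refine Finset.prod_congr rfl fun i _ => ?_
    have := hl i
    rw [sumNormSq_col_inv_sqrt hS, hc]
    field_simp
  have h1 : ∀ᵐ lam ∂(eigenvalueLaw q),
      ∫ U, (gramSINR δ (CFC.sqrt Sig) k (conjugateDiagonal (U, lam)) /
        (gramSINR δ (CFC.sqrt Sig) k (conjugateDiagonal (U, lam)) + s)) ^ n ∂(haarUnitary n) =
      ∏ i, lam i / (lam i + c * s) := by
    filter_upwards [ae_eigenvalueLaw_pos q] with lam hl using hin lam hl
  rw [integral_congr_ae h1, eigenvalueLaw, integral_withDensity_eq_integral_toReal_smul₀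
    hP.aemeasurable_eigenvalueDensity.ennreal_ofReal
    (Filter.Eventually.of_forall fun x => ENNReal.ofReal_lt_top),
    ← integral_eigenvalueDensity_mul_prod hn hP.monic hP.natDegree_eq hP.integrable
      hP.biorthonormal hcs]
  refine integral_congr_ae ?_
  filter_upwards [hP.density_nonneg] with lam hl
  rw [ENNReal.toReal_ofReal hl, smul_eq_mul]

end ensemble

/-- The continuous functions |f| and f agree almost everywhere on an open set, hence everywhere on
it. -/
lemma nonneg_of_ae_nonneg_of_continuousOn {f : ℝ → ℝ} (hf : ContinuousOn f (Ioi 0))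
    (h : ∀ᵐ x ∂(volume.restrict (Ioi (0 : ℝ))), 0 ≤ f x) {x : ℝ} (hx : 0 < x) : 0 ≤ f x := by
  have h1 : ∀ᵐ y ∂(volume.restrict (Ioi (0 : ℝ))), |f y| = f y := by
    filter_upwards [h] with y hy using abs_of_nonneg hy
  have h2 := Measure.eqOn_open_of_ae_eq h1 isOpen_Ioi hf.abs hf hx
  simp only at h2
  rw [← h2]
  exact abs_nonneg _

section ensemble
variable {Ω : Type*} [MeasurableSpace Ω] {μ : Measure Ω} {l m : ℕ}
  {P : Ω → Matrix (Fin l) (Fin (m + 2)) ℂ} {p : Fin (m + 2) → Polynomial ℝ}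
  {q : Fin (m + 2) → ℝ → ℝ} {Sig : Matrix (Fin (m + 2)) (Fin (m + 2)) ℂ} {δ : ℝ}

lemma IsInvariantPolynomialEnsemble.integrableOn_kernel
    (hP : IsInvariantPolynomialEnsemble μ P p q) : IntegrableOn (polyKernel p q 0) (Ioi 0) := by
  simpa using hP.integrableOn_pow_mul_kernel (a := 0) (by omega)

variable [IsProbabilityMeasure μ]

/-- The zero-forcing SINR has the claimed density, which is nonnegative. -/
lemma IsInvariantPolynomialEnsemble.zfSINR_density
    (hP : IsInvariantPolynomialEnsemble μ P p q) (hS : Sig.PosDef) (hδ : 0 < δ)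
    (k : Fin (m + 2)) :
    (∀ γ, 0 < γ → 0 ≤ zfDensity (m + 2) (polyKernel p q) (invDiag Sig k) δ γ) ∧
    μ.map (fun ω => zfSINR δ (P ω * CFC.sqrt Sig) k) = (volume.restrict (Ioi 0)).withDensity
      fun γ => ENNReal.ofReal (zfDensity (m + 2) (polyKernel p q) (invDiag Sig k) δ γ) := by
  have hσ := invDiag_pos hS k
  have hprob : IsProbabilityMeasure (μ.map fun ω => zfSINR δ (P ω * CFC.sqrt Sig) k) :=
    Measure.isProbabilityMeasure_map (hP.aemeasurable_zfSINR k)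
  obtain ⟨h1, h2⟩ := eq_withDensity_of_integral_resolvent (hP.map_zfSINR_Iic hS hδ k)
    (integrableOn_zfDensity (m := m) (K := polyKernel p q) hP.integrableOn_kernel hσ hδ)
    (n := m + 2) (by omega) fun s hs => by
      rw [hP.integral_resolvent_zfSINR hS hδ k hs,
        integral_zfDensity_mul_resolvent hP.integrableOn_kernel hσ hδ hs]
  exact ⟨fun γ hγ => nonneg_of_ae_nonneg_of_continuousOn
    (continuousOn_zfDensity m hP.integrableOn_kernel hσ hδ) h1 hγ, h2⟩

lemma IsInvariantPolynomialEnsemble.log_zfSINR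
    (hP : IsInvariantPolynomialEnsemble μ P p q) (hS : Sig.PosDef) (hδ : 0 < δ)
    (k : Fin (m + 2)) :
    Integrable (fun ω => Real.log (1 + zfSINR δ (P ω * CFC.sqrt Sig) k)) μ ∧
    ∫ ω, Real.log (1 + zfSINR δ (P ω * CFC.sqrt Sig) k) ∂μ =
      ∫ γ in Ioi (0 : ℝ), zfDensity (m + 2) (polyKernel p q) (invDiag Sig k) δ γ *
        Real.log (1 + γ) := by
  have hσ := invDiag_pos hS k
  obtain ⟨h1, h2⟩ := hP.zfSINR_density hS hδ k
  -- The first moment is available because the dimension m + 2 exceeds 1.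
  have hK1 : IntegrableOn (fun y => y * polyKernel p q 0 y) (Ioi 0) := by
    simpa using hP.integrableOn_pow_mul_kernel (a := 1) (by omega)
  have hlog := (zfDensity_mul_log (m := m) (K := polyKernel p q) hP.integrableOn_kernel hK1 hσ hδ).1
  have hae := hP.aemeasurable_zfSINR (Sig := Sig) (δ := δ) k
  have hlm : Measurable fun x : ℝ => Real.log (1 + x) := by fun_prop
  have hdm : AEMeasurable (fun γ => ENNReal.ofReal
      (zfDensity (m + 2) (polyKernel p q) (invDiag Sig k) δ γ)) (volume.restrict (Ioi 0)) :=
    (integrableOn_zfDensity hP.integrableOn_kernel hσ hδ).1.aemeasurable.ennreal_ofReal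
  have hlt : ∀ᵐ γ ∂(volume.restrict (Ioi (0 : ℝ))), ENNReal.ofReal
      (zfDensity (m + 2) (polyKernel p q) (invDiag Sig k) δ γ) < ⊤ :=
    Filter.Eventually.of_forall fun _ => ENNReal.ofReal_lt_top
  have hcongr : ∀ γ ∈ Ioi (0 : ℝ), (ENNReal.ofReal
      (zfDensity (m + 2) (polyKernel p q) (invDiag Sig k) δ γ)).toReal • Real.log (1 + γ) =
      zfDensity (m + 2) (polyKernel p q) (invDiag Sig k) δ γ * Real.log (1 + γ) := fun γ hγ => by
    rw [ENNReal.toReal_ofReal (h1 γ hγ), smul_eq_mul]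
  refine ⟨?_, ?_⟩
  · refine (integrable_map_measure hlm.aestronglyMeasurable hae).mp ?_
    rw [h2, integrable_withDensity_iff_integrable_smul₀' hdm hlt]
    exact (integrableOn_congr_fun hcongr measurableSet_Ioi).mpr hlog
  · rw [← integral_map hae hlm.aestronglyMeasurable, h2,
      integral_withDensity_eq_integral_toReal_smul₀ hdm hlt]
    exact setIntegral_congr_fun measurableSet_Ioi hcongr

end ensemble

theorem proposition1 {Ω : Type*} [MeasurableSpace Ω] (μ : Measure Ω) [IsProbabilityMeasure μ]
    (nr nt : ℕ) (hnt : 2 ≤ nt) (hnr : nt ≤ nr)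
    (P : Ω → Matrix (Fin nr) (Fin nt) ℂ)
    (p : Fin nt → Polynomial ℝ) (q : Fin nt → ℝ → ℝ)
    (hP : IsInvariantPolynomialEnsemble μ P p q)
    (Sigt : Matrix (Fin nt) (Fin nt) ℂ) (hSigt : Sigt.PosDef)
    (H : Ω → Matrix (Fin nr) (Fin nt) ℂ) (hH : ∀ ω, H ω = P ω * CFC.sqrt Sigt)
    (δ : ℝ) (hδ : 0 < δ) :
    (∀ k : Fin nt,
      (∀ γ : ℝ, 0 < γ →
        IntervalIntegrable
          (fun x => polyKernel p q 0 (invDiag Sigt k * γ * x / δ) * (1 - x) ^ (nt - 2) * x)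
          volume 0 1 ∧
        0 ≤ zfDensity nt (polyKernel p q) (invDiag Sigt k) δ γ) ∧
      AEMeasurable (fun ω => zfSINR δ (H ω) k) μ ∧
      μ.map (fun ω => zfSINR δ (H ω) k) =
        (volume.restrict (Ioi 0)).withDensity
          (fun γ => ENNReal.ofReal (zfDensity nt (polyKernel p q) (invDiag Sigt k) δ γ)) ∧
      Integrable (fun ω => Real.log (1 + zfSINR δ (H ω) k)) μ) ∧
    (∀ r : ℝ, IsMeijerAbscissa [1, 1] [1, 1] r →
      (∀ x : ℝ, 0 < x → ∀ k : Fin nt, Integrable (fun t : ℝ =>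
        meijerIntegrand [1, 1] [(nt : ℂ)] [1, 1] [0] ((δ / invDiag Sigt k * x : ℝ) : ℂ)
          ((r : ℂ) + (t : ℂ) * Complex.I))) ∧
      IntegrableOn (fun x : ℝ => (polyKernel p q 0 x : ℂ) *
        ∑ k : Fin nt, meijerG r [1, 1] [(nt : ℂ)] [1, 1] [0]
          ((δ / invDiag Sigt k * x : ℝ) : ℂ)) (Ioi 0) ∧
      ((sumRate μ (fun k ω => zfSINR δ (H ω) k) : ℝ) : ℂ) =
        ((nt - 1).factorial : ℂ) * ∫ x in Ioi (0 : ℝ), (polyKernel p q 0 x : ℂ) *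
          ∑ k : Fin nt, meijerG r [1, 1] [(nt : ℂ)] [1, 1] [0]
            ((δ / invDiag Sigt k * x : ℝ) : ℂ)) := by
  obtain ⟨m, rfl⟩ := Nat.exists_eq_add_of_le' hnt
  obtain rfl : H = fun ω => P ω * CFC.sqrt Sigt := funext hH
  have hK := hP.integrableOn_kernel
  have hK1 : IntegrableOn (fun y => y * polyKernel p q 0 y) (Ioi 0) := by
    simpa using hP.integrableOn_pow_mul_kernel (a := 1) (by omega)
  refine ⟨fun k => ⟨fun γ hγ => ⟨?_, (hP.zfSINR_density hSigt hδ k).1 γ hγ⟩,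
    hP.aemeasurable_zfSINR k, (hP.zfSINR_density hSigt hδ k).2, (hP.log_zfSINR hSigt hδ k).1⟩,
    fun r hr => ?_⟩
  · rw [intervalIntegrable_iff_integrableOn_Ioc_of_le zero_le_one]
    have h := integrable_convolution_weight hK m
      (mul_pos (div_pos (invDiag_pos hSigt k) hδ) hγ)
    refine h.congr (Filter.Eventually.of_forall fun x => ?_)
    simp only
    rw [show invDiag Sigt k / δ * γ * x = invDiag Sigt k * γ * x / δ by ring, Nat.add_sub_cancel]
  · have h1 : r < 1 := by simpa using hr.1 1 (by simp)
    have h0 : 0 < r := by simpa using hr.2 1 (by simp)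
    have hz : ∀ x : ℝ, 0 < x → ∀ k, 0 < δ / invDiag Sigt k * x := fun x hx k =>
      mul_pos (div_pos hδ (invDiag_pos hSigt k)) hx
    have hF := fun k => zfDensity_mul_log (m := m) (K := polyKernel p q) hK hK1
      (invDiag_pos hSigt k) hδ
    set F : Fin (m + 2) → ℝ → ℝ := fun k y => ((m : ℝ) + 1) *
      ∫ x in Ioc (0 : ℝ) 1, (1 - x) ^ m * Real.log (1 + δ / invDiag Sigt k * y / x)
    have hfac : ((m + 1).factorial : ℂ) ≠ 0 := Nat.cast_ne_zero.mpr (Nat.factorial_ne_zero _)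
    -- The complex contour integrals are replaced by real beta averages of logarithms, to which the
    -- Fubini identity for the rate applies.
    have hint : ∀ y ∈ Ioi (0 : ℝ), (polyKernel p q 0 y : ℂ) *
        ∑ k : Fin (m + 2), meijerG r [1, 1] [((m + 2 : ℕ) : ℂ)] [1, 1] [0]
          ((δ / invDiag Sigt k * y : ℝ) : ℂ) =
        ((m + 1).factorial : ℂ)⁻¹ * ((∑ k, polyKernel p q 0 y * F k y : ℝ) : ℂ) := by
      intro y hy
      have hsum : ∑ k : Fin (m + 2), meijerG r [1, 1] [((m + 2 : ℕ) : ℂ)] [1, 1] [0]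
          ((δ / invDiag Sigt k * y : ℝ) : ℂ) =
          ((m + 1).factorial : ℂ)⁻¹ * ((∑ k, F k y : ℝ) : ℂ) := by
        rw [Complex.ofReal_sum, Finset.mul_sum]
        refine Finset.sum_congr rfl fun k _ => ?_
        rw [← (meijerG_eq m h0 h1 (hz y hy k)).2, inv_mul_cancel_left₀ hfac]
      rw [hsum, mul_left_comm, ← Complex.ofReal_mul, Finset.mul_sum]
    refine ⟨fun x hx k => (meijerG_eq m h0 h1 (hz x hx k)).1, ?_, ?_⟩
    · refine (integrableOn_congr_fun hint measurableSet_Ioi).mpr (Integrable.const_mul ?_ _)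
      exact (integrable_finsetSum Finset.univ fun k _ => (hF k).2.1).ofReal
    · rw [setIntegral_congr_fun measurableSet_Ioi hint, integral_const_mul,
        show m + 2 - 1 = m + 1 from rfl, mul_inv_cancel_left₀ hfac, integral_complex_ofReal,
        integral_finsetSum _ fun k _ => (hF k).2.1, sumRate]
      congr 1
      exact Finset.sum_congr rfl fun k _ => (hP.log_zfSINR hSigt hδ k).2.trans (hF k).2.2
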